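/- Let $R$ be a Cohen--Macaulay local ring (in particular Noetherian) of dimension $d$ with maximal ideal $\mathfrak m$, and let $E$ be a finitely generated torsion-free $R$-module of rank $e\geq 1$ (i.e. $E\otimes_R Q\cong Q^e$ for $Q$ the total ring of fractions of $R$). Write $\mu(-)$ for the minimal number of generators. Assume that $E$ has projective dimension one, that $\mu(E)=d+e$, and that $E$ satisfies $G_d$, i.e. $\mu(E_{\mathfrak p})\leq \dim R_{\mathfrak p}+e-1$ for every $\mathfrak p\in\operatorname{Spec}(R)$ with $1\leq \dim R_{\mathfrak p}\leq d-1$. Let $\mathcal S(E)$ be the symmetric algebra of $E$, let $\mathcal A\subseteq \mathcal S(E)$ be its $R$-torsion, and let $\mathcal R(E)=\mathcal S(E)/\mathcal A$ be the Rees algebra of $E$. For a generating set $a_1,\ldots,a_{d+e}$ of $E$ and $B=R[y_1,\ldots,y_{d+e}]$, let $\mathcal L$ and $\mathcal J$ be the kernels of the natural maps $B\to\mathcal S(E)$, $y_i\mapsto a_i$, and $B\to\mathcal S(E)\to\mathcal R(E)$, so that $\mathcal S(E)\cong B/\mathcal L$ and $\mathcal R(E)\cong B/\mathcal J$. Then,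 for every such generating set: (a) The ideal $\mathcal L$ is generated by a $B$-regular sequence. (b) The module $E$ is of linear type on the punctured spectrum of $R$: for every $\mathfrak p\in\operatorname{Spec}(R)\setminus\{\mathfrak m\}$ one has $\mathcal A_{\mathfrak p}=0$, and $E_{\mathfrak p}$ is of linear type over $R_{\mathfrak p}$, i.e. the natural map $\mathcal S(E_{\mathfrak p})\to\mathcal R(E_{\mathfrak p})$ is an isomorphism. In particular, $\mathcal A=H^0_{\mathfrak m}(\mathcal S(E))=\{x\in\mathcal S(E) : \mathfrak m^n x=0 \text{ for some } n\}$, and $\mathcal J=\mathcal L:\mathfrak m^\infty=\bigcup_n(\mathcal L:_B\mathfrak m^nB)$. -/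

import Mathlib

open scoped nonZeroDivisors

universe u

/-- A Noetherian local ring is Cohen–Macaulay if its depth equals its dimension, that is, if the
maximal ideal contains an `R`-regular sequence of length `dim R`
(no `R`-regular sequence in the maximal ideal is longer than `dim R`). -/
def IsCohenMacaulayLocalRing (R : Type u) [CommRing R] [IsLocalRing R] : Prop :=
  IsNoetherianRing R ∧
    ∃ rs : List R, (∀ r ∈ rs, r ∈ IsLocalRing.maximalIdeal R) ∧
      RingTheory.Sequence.IsRegular R rs ∧ (rs.length : WithBot ℕ∞) = ringKrullDim R

/-- `E` has rank `e`: with `Q` the total ring of fractions of `R`, the `Q`-module `E ⊗ Q` is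
free of rank `e`. -/
def HasModuleRank (R : Type*) [CommRing R] (E : Type*) [AddCommGroup E] [Module R E]
    (e : ℕ) : Prop :=
  Nonempty (LocalizedModule R⁰ E ≃ₗ[Localization R⁰] (Fin e → Localization R⁰))

/-- The minimal number of generators `μ(E)` of a finitely generated module. -/
noncomputable def minGenerators (R : Type*) [CommRing R] (E : Type*) [AddCommGroup E]
    [Module R E] : ℕ :=
  (⊤ : Submodule R E).spanFinrank

/-- The condition `G_s` for a module `E` of rank `e`: `μ(E_𝔭) ≤ dim R_𝔭 + e - 1` for all primes
`𝔭` with `1 ≤ dim R_𝔭 ≤ s - 1`. -/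
def SatisfiesG (R : Type*) [CommRing R] (E : Type*) [AddCommGroup E] [Module R E]
    (e s : ℕ) : Prop :=
  ∀ (p : Ideal R) [p.IsPrime] (h : ℕ),
    ringKrullDim (Localization.AtPrime p) = h → 1 ≤ h → h + 1 ≤ s →
      minGenerators (Localization.AtPrime p) (LocalizedModule p.primeCompl E) + 1 ≤ h + e

section Rees

variable (R : Type*) [CommRing R] (E : Type*) [AddCommGroup E] [Module R E]

/-- The ideal `𝒜` of the symmetric algebra `𝒮(E)` consisting of its `R`-torsion. -/
def reesTorsionIdeal : Ideal (SymmetricAlgebra R E) where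
  carrier := {x | x ∈ Submodule.torsion R (SymmetricAlgebra R E)}
  add_mem' := fun hx hy => (Submodule.torsion R (SymmetricAlgebra R E)).add_mem hx hy
  zero_mem' := (Submodule.torsion R (SymmetricAlgebra R E)).zero_mem
  smul_mem' := by
    rintro c x ⟨a, ha⟩
    refine ⟨a, ?_⟩
    rw [smul_eq_mul, ← mul_smul_comm, ha, mul_zero]

/-- The Rees algebra of a module: the symmetric algebra modulo its `R`-torsion. -/
abbrev ModuleReesAlgebra : Type _ :=
  SymmetricAlgebra R E ⧸ reesTorsionIdeal R E

/-- `E` is of linear type if the natural map `𝒮(E) → ℛ(E)` is an isomorphism. -/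
def IsOfLinearType : Prop :=
  Function.Bijective (Ideal.Quotient.mkₐ R (reesTorsionIdeal R E) :
    SymmetricAlgebra R E → ModuleReesAlgebra R E)

variable {E} {n : ℕ}

/-- The natural map `R[y₁, …, yₙ] → 𝒮(E)`, `yᵢ ↦ aᵢ`. -/
noncomputable def symPresentation (a : Fin n → E) :
    MvPolynomial (Fin n) R →ₐ[R] SymmetricAlgebra R E :=
  MvPolynomial.aeval fun i => SymmetricAlgebra.ι R E (a i)

/-- The natural map `R[y₁, …, yₙ] → 𝒮(E) → ℛ(E)`. -/
noncomputable def reesPresentation (a : Fin n → E) :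
    MvPolynomial (Fin n) R →ₐ[R] ModuleReesAlgebra R E :=
  (Ideal.Quotient.mkₐ R (reesTorsionIdeal R E)).comp (symPresentation R a)

/-- The defining ideal `ℒ` of the symmetric algebra. -/
noncomputable def symDefiningIdeal (a : Fin n → E) : Ideal (MvPolynomial (Fin n) R) :=
  RingHom.ker (symPresentation R a)

/-- The defining ideal `𝒥` of the Rees algebra. -/
noncomputable def reesDefiningIdeal (a : Fin n → E) : Ideal (MvPolynomial (Fin n) R) :=
  RingHom.ker (reesPresentation R a)

end Rees

/-- The zeroth local cohomology `H⁰_I(M)`: all elements killed by a power of `I`. -/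
def localCohomologyZero {R : Type*} [CommRing R] (I : Ideal R) (M : Type*) [AddCommGroup M]
    [Module R M] : Submodule R M where
  carrier := {x | ∃ n : ℕ, ∀ r ∈ I ^ n, r • x = 0}
  add_mem' := by
    rintro x y ⟨m, hm⟩ ⟨n, hn⟩
    refine ⟨m + n, fun r hr => ?_⟩
    rw [smul_add, hm r (Ideal.pow_le_pow_right (Nat.le_add_right m n) hr),
      hn r (Ideal.pow_le_pow_right (Nat.le_add_left n m) hr), add_zero]
  zero_mem' := ⟨0, fun r _ => smul_zero r⟩
  smul_mem' := by
    rintro c x ⟨n, hn⟩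
    exact ⟨n, fun r hr => by rw [smul_comm, hn r hr, smul_zero]⟩

/-- The saturation `L : I^∞ = ⋃ₙ (L : Iⁿ)` of an ideal `L` of an `R`-algebra `B` with respect to
(the extension to `B` of) an ideal `I` of `R`. -/
def idealSaturation {R B : Type*} [CommRing R] [CommRing B] [Algebra R B] (L : Ideal B)
    (I : Ideal R) : Ideal B where
  carrier := {b | ∃ n : ℕ, ∀ c ∈ (I.map (algebraMap R B)) ^ n, c * b ∈ L}
  add_mem' := by
    rintro x y ⟨m, hm⟩ ⟨n, hn⟩
    refine ⟨m + n, fun c hc => ?_⟩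
    rw [mul_add]
    exact L.add_mem (hm c (Ideal.pow_le_pow_right (Nat.le_add_right m n) hc))
      (hn c (Ideal.pow_le_pow_right (Nat.le_add_left n m) hc))
  zero_mem' := ⟨0, fun c _ => by rw [mul_zero]; exact L.zero_mem⟩
  smul_mem' := by
    rintro b x ⟨n, hn⟩
    refine ⟨n, fun c hc => ?_⟩
    rw [smul_eq_mul, mul_left_comm]
    exact L.mul_mem_left b (hn c hc)

/-! ### Grade of an ideal on a module, through vanishing of Ext -/

section Grade

open CategoryTheory Abelian RingTheory.Sequence Pointwise

variable {R : Type u} [CommRing R]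

/-! By projective dimension one and the rank, the relations on `a₁, …, a_{d+e}` form a free module
of rank `d`, so `ℒ` is generated by `d` linear forms in `B`. Both the regularity of these forms and
the control of torsion come from one grade estimate, `not_isWeaklyRegular_of_colon_eq_prime`.

Suppose `f ∈ B ⧸ (zs)`, with `zs` regular, has `R`-annihilator a prime `q` of height `h`, and is
also killed by `c` linear forms independent over the residue field of `q`. After localizing at `q`,
the annihilator of `f` contains a regular sequence of length `h`, because `R` is Cohen–Macaulay,
followed by `c` forms that are part of a system of coordinates. Its grade is thus at least `h + c`,
and since `f ≠ 0` this forces `h + c ≤ length zs`.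

Counting generators of `E_q` bounds the rank of the relations at `q` from below
(`hasLargeRank_of_satisfiesG`): at least `d - h` always, by the rank of `E` if `h = 0`, and at least
`d + 1 - h` if `0 < h < d`, by `G_d`. The first bound makes each form a nonzerodivisor modulo its
predecessors. The second leaves only minimal primes and `𝔪` as possible associated primes of `𝒮(E)`
over `R`. Minimal primes contain no nonzerodivisors, so torsion can live only at `𝔪`; this gives
linear type on the punctured spectrum and identifies `𝒜` and `𝒥`. -/

/-- The vanishing of `Ext^i(R/I, M)` for `i < n`, i.e. the grade of `I` on `M` is at least `n`. -/
def HasGradeGE (I : Ideal R) (n : ℕ) (M : Type u) [AddCommGroup M] [Module R M] : Prop :=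
  ∀ i < n, Subsingleton (Ext (ModuleCat.of R (R ⧸ I)) (ModuleCat.of R M) i)

variable {I : Ideal R} {M : Type u} [AddCommGroup M] [Module R M]

lemma HasGradeGE.congr {n : ℕ} {N : Type u} [AddCommGroup N] [Module R N] (h : HasGradeGE I n M)
    (e : M ≃ₗ[R] N) : HasGradeGE I n N := by
  intro i hi
  have : Subsingleton ((extFunctorObj (ModuleCat.of R (R ⧸ I)) i).obj (ModuleCat.of R M)) := h i hi
  exact ((extFunctorObj (ModuleCat.of R (R ⧸ I)) i).mapIso
    e.toModuleIso).addCommGroupIsoToAddEquiv.symm.subsingleton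

/-- Long exact Ext sequence of `0 → M → M → M ⧸ xM → 0`. The element `x` need not lie in `I`. -/
lemma HasGradeGE.quotSMulTop {n : ℕ} (h : HasGradeGE I (n + 1) M) {x : R}
    (hx : IsSMulRegular M x) : HasGradeGE I n (QuotSMulTop x M) := by
  intro i hi
  have zero1 := AddCommGrpCat.isZero_of_iff_subsingleton.mpr (h i (by omega))
  have zero2 := AddCommGrpCat.isZero_of_iff_subsingleton.mpr (h (i + 1) (by omega))
  have hx' : IsSMulRegular (ModuleCat.of R M) x := hx
  exact AddCommGrpCat.subsingleton_of_isZero <| ShortComplex.Exact.isZero_of_both_zeros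
    ((Ext.covariant_sequence_exact₃' (ModuleCat.of R (R ⧸ I))
      hx'.smulShortComplex_shortExact) i (i + 1) rfl)
    (zero1.eq_zero_of_src _) (zero2.eq_zero_of_tgt _)

/-- Induction on the sequence: vanishing for `M ⧸ aM` makes multiplication by `a` injective on the
next Ext of `M`, but it is also zero there, since `a ∈ I` annihilates `R ⧸ I`. -/
lemma HasGradeGE.of_isWeaklyRegular {xs : List R} (hmem : ∀ x ∈ xs, x ∈ I)
    (hxs : IsWeaklyRegular M xs) : HasGradeGE I xs.length M := by
  induction xs generalizing M with
  | nil => intro i hi; simp at hi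
  | cons a xs ih =>
    rw [isWeaklyRegular_cons_iff] at hxs
    simp only [List.mem_cons, forall_eq_or_imp] at hmem
    have ha : a ∈ Module.annihilator R (ModuleCat.of R (R ⧸ I)) := by
      rw [show Module.annihilator R (ModuleCat.of R (R ⧸ I)) = I from Ideal.annihilator_quotient]
      exact hmem.1
    have hreg : IsSMulRegular (ModuleCat.of R M) a := hxs.1
    intro i hi
    match i with
    | 0 =>
      have : Subsingleton (ModuleCat.of R (R ⧸ I) →ₗ[R] ModuleCat.of R M) :=
        IsSMulRegular.linearMap_subsingleton_of_mem_annihilator hreg ha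
      exact (Ext.addEquiv₀.trans ModuleCat.homAddEquiv).subsingleton
    | i + 1 =>
      let g := (AddCommGrpCat.ofHom
        ((Ext.mk₀ (ModuleCat.smulShortComplex (ModuleCat.of R M) a).f).postcomp
          (ModuleCat.of R (R ⧸ I)) (add_zero (i + 1))))
      have mono_g : Mono g := by
        apply (Ext.covariant_sequence_exact₁' (ModuleCat.of R (R ⧸ I))
          hreg.smulShortComplex_shortExact i (i + 1) rfl).mono_g
          ((AddCommGrpCat.isZero_of_iff_subsingleton.mpr ?_).eq_zero_of_src _)
        exact ih hmem.2 hxs.2 i (by simpa using hi)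
      have zero_g : g = 0 := Ext.postcomp_smul_id_eq_zero_of_mem_annihilator ha (i + 1)
      exact AddCommGrpCat.subsingleton_of_isZero (Limits.IsZero.of_mono_eq_zero _ zero_g)

lemma HasGradeGE.subsingleton_linearMap {n : ℕ} (h : HasGradeGE I (n + 1) M) :
    Subsingleton ((R ⧸ I) →ₗ[R] M) := by
  have := h 0 n.succ_pos
  exact (Ext.addEquiv₀.trans (ModuleCat.homAddEquiv (M := ModuleCat.of R (R ⧸ I))
    (N := ModuleCat.of R M))).symm.subsingleton

lemma HasGradeGE.eq_zero {n : ℕ} (h : HasGradeGE I (n + 1) M) {m : M}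
    (hm : ∀ r ∈ I, r • m = 0) : m = 0 := by
  have := h.subsingleton_linearMap
  let f : (R ⧸ I) →ₗ[R] M := Submodule.liftQ I (LinearMap.toSpanSingleton R M m)
    (fun r hr => by simpa using hm r hr)
  have hf : f (Ideal.Quotient.mk I 1) = m := by
    change LinearMap.toSpanSingleton R M m 1 = m
    simp
  rw [← hf, Subsingleton.elim f 0, LinearMap.zero_apply]

lemma HasGradeGE.exists_isSMulRegular [IsNoetherianRing R] [Module.Finite R M] {n : ℕ}
    (h : HasGradeGE I (n + 1) M) : ∃ x ∈ I, IsSMulRegular M x := by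
  have := h.subsingleton_linearMap
  have h' := IsSMulRegular.subsingleton_linearMap_iff.mp this
  rwa [Ideal.annihilator_quotient] at h'

/-- Each term costs at most one unit of grade, whether or not it lies in `I`; the application takes
for `I` a colon ideal. -/
lemma HasGradeGE.quotient_ofList {n : ℕ} (zs : List R) (hzs : IsWeaklyRegular M zs)
    (h : HasGradeGE I (n + zs.length) M) :
    HasGradeGE I n (M ⧸ (Ideal.ofList zs • ⊤ : Submodule R M)) := by
  induction zs generalizing M with
  | nil =>
    exact h.congr (Submodule.quotEquivOfEqBot _ (by simp [Submodule.bot_smul])).symm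
  | cons a zs ih =>
    rw [isWeaklyRegular_cons_iff] at hzs
    exact (ih hzs.2 (HasGradeGE.quotSMulTop (n := n + zs.length) h hzs.1)).congr
      (Submodule.quotOfListConsSMulTopEquivQuotSMulTopInner M a zs).symm

/-- If `I` contains a weakly `M`-regular sequence longer than `zs`, then `M ⧸ zs M` contains no
nonzero element killed by `I`. -/
lemma eq_zero_of_isWeaklyRegular_of_length_lt {xs zs : List R} (hxs : ∀ x ∈ xs, x ∈ I)
    (hxs' : IsWeaklyRegular M xs) (hzs : IsWeaklyRegular M zs) (hlt : zs.length < xs.length)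
    {m : M ⧸ (Ideal.ofList zs • ⊤ : Submodule R M)} (hm : ∀ r ∈ I, r • m = 0) : m = 0 := by
  have h := HasGradeGE.of_isWeaklyRegular hxs hxs'
  obtain ⟨k, hk⟩ := Nat.exists_eq_add_of_lt hlt
  rw [hk, show zs.length + k + 1 = (k + 1) + zs.length by omega] at h
  exact (h.quotient_ofList zs hzs).eq_zero hm

end Grade

/-! ### Grade equals height at the primes of a Cohen–Macaulay local ring -/

section CohenMacaulay

open RingTheory.Sequence Pointwise

variable {R : Type u} [CommRing R]

/-- Over a Noetherian local ring, the grade of the maximal ideal on `M` is at most the dimension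
of `R ⧸ q` for each associated prime `q` of `M`. -/
lemma HasGradeGE.le_coheight_of_mem_associatedPrimes [IsLocalRing R] [IsNoetherianRing R] {n : ℕ}
    {M : Type u} [AddCommGroup M] [Module R M] [Module.Finite R M]
    (h : HasGradeGE (IsLocalRing.maximalIdeal R) n M) (q : PrimeSpectrum R)
    (hq : IsAssociatedPrime q.asIdeal M) : (n : ℕ∞) ≤ Order.coheight q := by
  induction n generalizing M q with
  | zero => simp
  | succ n ih =>
    obtain ⟨x, hxm, hx⟩ := h.exists_isSMulRegular
    obtain ⟨-, m, hm⟩ := isAssociatedPrime_iff.mp hq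
    have hqm : ∀ r, r ∈ q.asIdeal ↔ r • m = 0 := fun r => by
      rw [hm, Submodule.mem_colon_singleton, Submodule.mem_bot]
    have hm0 : m ≠ 0 := by
      rintro rfl
      exact q.isPrime.ne_top ((Ideal.eq_top_iff_one _).mpr ((hqm 1).mpr (smul_zero _)))
    -- `N` consists of the elements killed by `q`. If `N ⊆ xM`, regularity of `x` gives `N = xN`,
    -- and Nakayama gives `N = 0`.
    let N : Submodule R M :=
      { carrier := {z | ∀ r ∈ q.asIdeal, r • z = 0}
        add_mem' := fun ha hb r hr => by rw [smul_add, ha r hr, hb r hr, add_zero]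
        zero_mem' := fun r _ => smul_zero r
        smul_mem' := fun c z hz r hr => by rw [smul_comm, hz r hr, smul_zero] }
    have hmN : m ∈ N := fun r hr => (hqm r).mp hr
    obtain ⟨z, hzN, hzx⟩ : ∃ z ∈ N, z ∉ (x • ⊤ : Submodule R M) := by
      by_contra! hcon
      have hN : N = ⊥ := by
        refine Submodule.eq_bot_of_le_smul_of_le_jacobson_bot (IsLocalRing.maximalIdeal R) N
          (IsNoetherian.noetherian N) (fun z hz => ?_) (IsLocalRing.maximalIdeal_le_jacobson _)
        obtain ⟨w, -, rfl⟩ := (Submodule.mem_smul_pointwise_iff_exists _ _ _).mp (hcon z hz)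
        refine Submodule.smul_mem_smul hxm fun r hr => hx ?_
        change x • r • w = x • 0
        rw [smul_comm, hz r hr, smul_zero]
      exact hm0 ((Submodule.mem_bot R).mp (hN ▸ hmN))
    have hz0 : (Submodule.Quotient.mk z : QuotSMulTop x M) ≠ 0 := by
      rwa [Ne, Submodule.Quotient.mk_eq_zero]
    obtain ⟨P, hP, hle⟩ := exists_le_isAssociatedPrime_of_isNoetherianRing R _ hz0
    -- The class of `z` is killed by `q` and by `x ∉ q`, so `P` lies strictly above `q`: the
    -- coheight drops along with the grade.
    have hqP : q < ⟨P, hP.isPrime⟩ := by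
      refine lt_of_le_of_ne (fun r hr => hle ?_) fun heq => ?_
      · rw [Submodule.mem_colon_singleton, Submodule.mem_bot, ← Submodule.Quotient.mk_smul,
          hzN r hr, Submodule.Quotient.mk_zero]
      · have hxP : x ∈ P := hle <| by
          rw [Submodule.mem_colon_singleton, Submodule.mem_bot, ← Submodule.Quotient.mk_smul,
            Submodule.Quotient.mk_eq_zero]
          exact Submodule.smul_mem_pointwise_smul _ _ _ trivial
        have hxq : x ∈ q.asIdeal := by rw [heq]; exact hxP
        exact hm0 (hx (by simpa using (hqm x).mp hxq))
    have := ih (h.quotSMulTop hx) ⟨P, hP.isPrime⟩ hP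
    calc ((n + 1 : ℕ) : ℕ∞) = n + 1 := by push_cast; rfl
      _ ≤ Order.coheight (⟨P, hP.isPrime⟩ : PrimeSpectrum R) + 1 := by gcongr
      _ ≤ Order.coheight q := Order.coheight_add_one_le hqP

/-- The grade of a prime `q` on `M` is at least the grade of the maximal ideal on `M` minus the
dimension of `R ⧸ q`. -/
lemma HasGradeGE.exists_isWeaklyRegular_mem_prime [IsLocalRing R] [IsNoetherianRing R] {n : ℕ}
    {M : Type u} [AddCommGroup M] [Module R M] [Module.Finite R M]
    (h : HasGradeGE (IsLocalRing.maximalIdeal R) n M) (q : PrimeSpectrum R) (k : ℕ)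
    (hk : k + Order.coheight q ≤ n) :
    ∃ xs : List R, xs.length = k ∧ (∀ x ∈ xs, x ∈ q.asIdeal) ∧ IsWeaklyRegular M xs := by
  induction k generalizing M n with
  | zero => exact ⟨[], rfl, by simp, IsWeaklyRegular.nil R M⟩
  | succ k ih =>
    obtain ⟨c, hc⟩ : ∃ c : ℕ, Order.coheight q = c := by
      refine ENat.ne_top_iff_exists.mp (fun htop => ?_) |>.imp fun _ h => h.symm
      rw [htop] at hk
      simp at hk
    rw [hc] at hk
    norm_cast at hk
    obtain ⟨n, rfl⟩ : ∃ n', n = n' + 1 := ⟨n - 1, by omega⟩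
    -- Otherwise some associated prime `P` of `M` contains `q`, so the grade of the maximal ideal is
    -- at most the coheight of `P`, hence of `q`, which is less than `n + 1`.
    obtain ⟨x, hxq, hx⟩ : ∃ x ∈ q.asIdeal, IsSMulRegular M x := by
      have hiff := IsSMulRegular.subsingleton_linearMap_iff (R := R) (M := M)
        (N := R ⧸ q.asIdeal)
      rw [Ideal.annihilator_quotient] at hiff
      rw [← hiff]
      refine subsingleton_of_forall_eq 0 fun f => ?_
      by_contra hf
      have hf1 : f 1 ≠ 0 := fun h1 => hf <| by
        ext
        simpa using h1
      obtain ⟨P, hP, hle⟩ := exists_le_isAssociatedPrime_of_isNoetherianRing R _ hf1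
      have hqP : q ≤ ⟨P, hP.isPrime⟩ := fun r hr => hle <| by
        rw [Submodule.mem_colon_singleton, Submodule.mem_bot, ← map_smul,
          show r • (1 : R ⧸ q.asIdeal) = 0 by
            rw [Algebra.smul_def, mul_one]; exact Ideal.Quotient.eq_zero_iff_mem.mpr hr, map_zero]
      have h1 := (h.le_coheight_of_mem_associatedPrimes ⟨P, hP.isPrime⟩ hP).trans
        (Order.coheight_anti hqP)
      rw [hc] at h1
      norm_cast at h1
      omega
    obtain ⟨xs, hlen, hmem, hreg⟩ := ih (h.quotSMulTop hx) (by
      rw [hc]; norm_cast; omega)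
    exact ⟨x :: xs, by simp [hlen], by simpa using ⟨hxq, hmem⟩, IsWeaklyRegular.cons hx hreg⟩

/-- In a Cohen–Macaulay local ring, every prime contains a regular sequence whose length is the
height of the prime. -/
lemma IsCohenMacaulayLocalRing.exists_isWeaklyRegular_mem_prime [IsLocalRing R]
    (hR : IsCohenMacaulayLocalRing R) (q : Ideal R) [q.IsPrime] (k : ℕ) (hk : q.height = k) :
    ∃ xs : List R, xs.length = k ∧ (∀ x ∈ xs, x ∈ q) ∧ IsWeaklyRegular R xs := by
  obtain ⟨_, rs, hmem, hreg, hlen⟩ := hR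
  have h := HasGradeGE.of_isWeaklyRegular hmem hreg.toIsWeaklyRegular
  refine h.exists_isWeaklyRegular_mem_prime ⟨q, ‹_›⟩ k ?_
  -- Only the inequality `height q + coheight q ≤ dim R` is needed.
  have h1 := Order.krullDim_eq_iSup_height_add_coheight_of_nonempty (α := PrimeSpectrum R)
  have h2 := le_iSup (fun a : PrimeSpectrum R => Order.height a + Order.coheight a) ⟨q, ‹_›⟩
  have h3 : ((rs.length : ℕ∞) : WithBot ℕ∞) =
      ((⨆ a : PrimeSpectrum R, Order.height a + Order.coheight a : ℕ∞) : WithBot ℕ∞) := by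
    rw [← h1]; exact hlen
  rw [← WithBot.coe_inj.mp h3] at h2
  have h4 := PrimeSpectrum.height_eq_orderHeight (⟨q, ‹_›⟩ : PrimeSpectrum R)
  simp only [hk] at h4
  rw [h4]
  exact h2

end CohenMacaulay

/-! ### Regular sequences in polynomial rings; linear forms -/

section PolynomialRegular

open RingTheory.Sequence Pointwise

open Polynomial in
/-- Adjoining a variable prolongs a weakly regular sequence. -/
lemma RingTheory.Sequence.IsWeaklyRegular.polynomial {A : Type*} [CommRing A] {rs : List A}
    (h : IsWeaklyRegular A rs) :
    IsWeaklyRegular (Polynomial A) (Polynomial.X :: rs.map Polynomial.C) := by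
  rw [isWeaklyRegular_cons_iff]
  refine ⟨fun p q hpq => ?_, ?_⟩
  · exact isRegular_X.left hpq
  -- Modulo `X`, the ring `A[X]` becomes `A` with `C r` acting as `r`, so the remaining terms are
  -- the given sequence on `A`.
  · let f : A[X] →ₛₗ[(constantCoeff (R := A))] A :=
      { toFun := constantCoeff
        map_add' := map_add _
        map_smul' := fun p q => by simp }
    have hle : ((X : A[X]) • ⊤ : Submodule A[X] A[X]) ≤ LinearMap.ker f := by
      intro p hp
      obtain ⟨q, -, rfl⟩ := (Submodule.mem_smul_pointwise_iff_exists _ _ _).mp hp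
      simp [f]
    let g := Submodule.liftQ _ f hle
    have hg : Function.Bijective g := by
      refine ⟨(injective_iff_map_eq_zero g).mpr fun x hx => ?_, fun a => ?_⟩
      · obtain ⟨p, rfl⟩ := Submodule.Quotient.mk_surjective _ x
        have hp : p.coeff 0 = 0 := hx
        rw [Submodule.Quotient.mk_eq_zero]
        obtain ⟨q, rfl⟩ := X_dvd_iff.mpr hp
        exact Submodule.smul_mem_pointwise_smul _ _ _ trivial
      · exact ⟨Submodule.Quotient.mk (C a), by
          change constantCoeff (C a) = a
          simp⟩
    let e : QuotSMulTop (X : A[X]) A[X] ≃+ A := AddEquiv.ofBijective g hg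
    refine (AddEquiv.isWeaklyRegular_congr (e := e) ?_).mpr h
    rw [List.forall₂_map_left_iff, List.forall₂_same]
    intro r _ x
    change g (C r • x) = r • g x
    rw [map_smulₛₗ]
    simp

lemma RingTheory.Sequence.IsWeaklyRegular.map_ringEquiv {A B : Type*} [CommRing A] [CommRing B]
    {rs : List A} (h : IsWeaklyRegular A rs) (e : A ≃+* B) :
    IsWeaklyRegular B (rs.map e) := by
  refine (AddEquiv.isWeaklyRegular_congr (e := e.toAddEquiv) ?_).mp h
  rw [List.forall₂_map_right_iff, List.forall₂_same]
  intro r _ x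
  simp

/-- Adjoining finitely many variables prolongs a weakly regular sequence by as many terms. -/
lemma RingTheory.Sequence.IsWeaklyRegular.exists_mvPolynomial {A : Type*} [CommRing A]
    {rs : List A} (h : IsWeaklyRegular A rs) (n : ℕ) :
    ∃ ss : List (MvPolynomial (Fin n) A), ss.length = rs.length + n ∧
      (∀ s ∈ ss, s ∈ Ideal.span (MvPolynomial.C '' {r | r ∈ rs} ∪ Set.range MvPolynomial.X)) ∧
      IsWeaklyRegular (MvPolynomial (Fin n) A) ss := by
  induction n with
  | zero =>
    let e : A ≃+* MvPolynomial (Fin 0) A := (MvPolynomial.isEmptyRingEquiv A (Fin 0)).symm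
    refine ⟨rs.map e, by simp, ?_, h.map_ringEquiv e⟩
    intro s hs
    obtain ⟨r, hr, rfl⟩ := List.mem_map.mp hs
    exact Ideal.subset_span (Or.inl ⟨r, hr, rfl⟩)
  | succ n ih =>
    obtain ⟨ss, hlen, hmem, hreg⟩ := ih
    let e := (MvPolynomial.finSuccEquiv A n).symm.toRingEquiv
    refine ⟨(Polynomial.X :: ss.map Polynomial.C).map e, by simp [hlen]; omega, ?_,
      hreg.polynomial.map_ringEquiv e⟩
    have heC : ∀ p, e (Polynomial.C p) = MvPolynomial.rename Fin.succ p := fun p => by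
      change (MvPolynomial.finSuccEquiv A n).symm (Polynomial.C p) = _
      rw [AlgEquiv.symm_apply_eq]
      induction p using MvPolynomial.induction_on with
      | C a => simp [MvPolynomial.finSuccEquiv_apply]
      | add p q hp hq => simp [hp, hq]
      | mul_X p i hp => rw [map_mul, map_mul, map_mul, hp]; simp [MvPolynomial.finSuccEquiv_X_succ]
    have heX : e Polynomial.X = MvPolynomial.X 0 := by
      change (MvPolynomial.finSuccEquiv A n).symm Polynomial.X = _
      rw [AlgEquiv.symm_apply_eq, MvPolynomial.finSuccEquiv_X_zero]
    intro s hs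
    simp only [List.map_cons, List.mem_cons, List.map_map, List.mem_map, Function.comp] at hs
    rcases hs with rfl | ⟨p, hp, rfl⟩
    · rw [heX]
      exact Ideal.subset_span (Or.inr ⟨0, rfl⟩)
    · rw [heC]
      have h1 := Ideal.mem_map_of_mem (MvPolynomial.rename (R := A) Fin.succ : _ →ₐ[A] _)
        (hmem p hp)
      refine (Ideal.map_le_iff_le_comap.mpr (Ideal.span_le.mpr ?_)) h1
      rintro _ (⟨r, hr, rfl⟩ | ⟨i, rfl⟩)
      · simp only [SetLike.mem_coe, Ideal.mem_comap]
        refine Ideal.subset_span (Or.inl ⟨r, hr, ?_⟩)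
        simp
      · simp only [SetLike.mem_coe, Ideal.mem_comap]
        refine Ideal.subset_span (Or.inr ⟨i.succ, ?_⟩)
        simp

/-- The linear form `∑ vᵢ Xᵢ` attached to a vector `v`. -/
noncomputable def linearForm {σ : Type*} [Fintype σ] (A : Type*) [CommRing A] :
    (σ → A) →ₗ[A] MvPolynomial σ A :=
  Fintype.linearCombination A MvPolynomial.X

lemma linearForm_apply {σ : Type*} [Fintype σ] {A : Type*} [CommRing A] (v : σ → A) :
    linearForm A v = ∑ i, MvPolynomial.C (v i) * MvPolynomial.X i := by
  simp [linearForm, Fintype.linearCombination_apply, MvPolynomial.smul_eq_C_mul]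

lemma map_linearForm {σ : Type*} [Fintype σ] {A B : Type*} [CommRing A] [CommRing B]
    (f : A →+* B) (v : σ → A) :
    MvPolynomial.map f (linearForm A v) = linearForm B (f ∘ v) := by
  simp [linearForm_apply]

end PolynomialRegular

/-! ### Residually independent linear forms as coordinates -/

section LinearFormsRegular

open RingTheory.Sequence Pointwise

/-- Over a local ring, vectors in `Aⁿ` that are linearly independent over the residue field form
part of a basis. -/
lemma IsLocalRing.exists_basis_sum_of_linearIndependent_residue {A : Type u} [CommRing A]
    [IsLocalRing A] {n : ℕ} {κ : Type*} (v : κ → Fin n → A)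
    (hv : LinearIndependent (IsLocalRing.ResidueField A)
      fun k => IsLocalRing.residue A ∘ v k) :
    ∃ (κ' : Type u) (b : Module.Basis (κ ⊕ κ') A (Fin n → A)),
      ∀ k, b (Sum.inl k) = v k := by
  classical
  let B := Module.Basis.sumExtend hv
  have hB : ∀ k, B (Sum.inl k) = IsLocalRing.residue A ∘ v k := fun k => by
    simp only [B, Module.Basis.sumExtend, Module.Basis.reindex_apply, Module.Basis.extend_apply_self]
    rfl
  choose w hw using fun k' => (IsLocalRing.residue_surjective (R := A)).comp_left (B (Sum.inr k'))
  let u := Sum.elim v w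
  have hu : ∀ s, IsLocalRing.residue A ∘ u s = B s := by
    rintro (k | k')
    · exact (hB k).symm
    · exact hw k'
  let σ := (Pi.basisFun (IsLocalRing.ResidueField A) (Fin n)).indexEquiv B
  have h1 := (Module.Basis.is_basis_iff_det (Pi.basisFun (IsLocalRing.ResidueField A) (Fin n))
    (v := B ∘ σ)).mp ⟨B.linearIndependent.comp _ σ.injective, by
      rw [Set.range_comp, σ.range_eq_univ, Set.image_univ, B.span_eq]⟩
  -- The determinant of the lifted vectors reduces to the determinant of a basis over the residue
  -- field, and over a local ring units are detected there.
  have h2 : IsUnit ((Pi.basisFun A (Fin n)).det (u ∘ σ)) := by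
    rw [Pi.basisFun_det] at h1 ⊢
    refine isUnit_of_map_unit (IsLocalRing.residue A) _ ?_
    change IsUnit (IsLocalRing.residue A (Matrix.det (Matrix.of (u ∘ σ))))
    rw [RingHom.map_det]
    convert h1 using 1
    change Matrix.det _ = Matrix.det _
    congr 1
    ext i j
    exact congrFun (hu (σ i)) j
  obtain ⟨h3, h4⟩ := (Module.Basis.is_basis_iff_det (Pi.basisFun A (Fin n))).mpr h2
  refine ⟨_, (Module.Basis.mk h3 h4.ge).reindex σ, fun k => ?_⟩
  simp [u]

/-- Over a local ring, a weakly regular sequence of the base ring is prolonged in the polynomial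
ring by linear forms which are linearly independent over the residue field. -/
lemma RingTheory.Sequence.IsWeaklyRegular.exists_mvPolynomial_linearForm {A : Type*} [CommRing A]
    [IsLocalRing A] {n : ℕ} {κ : Type*} [Finite κ] (v : κ → Fin n → A)
    (hv : LinearIndependent (IsLocalRing.ResidueField A)
      fun k => IsLocalRing.residue A ∘ v k)
    {rs : List A} (h : IsWeaklyRegular A rs) (J : Ideal (MvPolynomial (Fin n) A))
    (hJ : ∀ r ∈ rs, MvPolynomial.C r ∈ J) (hJ' : ∀ k, linearForm A (v k) ∈ J) :
    ∃ ss : List (MvPolynomial (Fin n) A), ss.length = rs.length + Nat.card κ ∧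
      (∀ s ∈ ss, s ∈ J) ∧ IsWeaklyRegular (MvPolynomial (Fin n) A) ss := by
  obtain ⟨κ', b, hb⟩ := IsLocalRing.exists_basis_sum_of_linearIndependent_residue v hv
  -- Both sides are the symmetric algebra of `Aⁿ`, written in two bases; the variables indexed by
  -- `κ` become the given linear forms.
  let e₁ : MvPolynomial (κ ⊕ κ') A ≃ₐ[A] MvPolynomial (Fin n) A :=
    (SymmetricAlgebra.equivMvPolynomial b).symm.trans
      (SymmetricAlgebra.equivMvPolynomial (Pi.basisFun A (Fin n)))
  have he₁ : ∀ k, e₁ (MvPolynomial.X (Sum.inl k)) = linearForm A (v k) := fun k => by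
    have hι : ∀ w : Fin n → A, SymmetricAlgebra.equivMvPolynomial (Pi.basisFun A (Fin n))
        (SymmetricAlgebra.ι A _ w) = linearForm A w := fun w => by
      refine LinearMap.congr_fun (f := (SymmetricAlgebra.equivMvPolynomial
        (Pi.basisFun A (Fin n))).toLinearMap ∘ₗ SymmetricAlgebra.ι A (Fin n → A)) ?_ w
      refine (Pi.basisFun A (Fin n)).ext fun i => ?_
      rw [LinearMap.comp_apply, AlgEquiv.toLinearMap_apply,
        SymmetricAlgebra.equivMvPolynomial_ι_apply]
      simp [linearForm, Fintype.linearCombination_apply_single]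
    simp only [e₁, AlgEquiv.trans_apply, SymmetricAlgebra.equivMvPolynomial_symm_X, hb, hι]
  -- The variables in `κ'` are absorbed into the coefficients, over which `rs` stays regular by
  -- flatness; only the `κ`-variables are then adjoined as terms.
  let e₂ : MvPolynomial (Fin (Nat.card κ)) (MvPolynomial κ' A) ≃ₐ[A] MvPolynomial (κ ⊕ κ') A :=
    (MvPolynomial.renameEquiv (MvPolynomial κ' A) (Finite.equivFin κ).symm).restrictScalars A
      |>.trans (MvPolynomial.sumAlgEquiv A κ κ').symm
  let e := e₂.trans e₁
  have h0 : IsWeaklyRegular (MvPolynomial κ' A) (rs.map (algebraMap A (MvPolynomial κ' A))) :=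
    h.of_flat
  obtain ⟨ss, hlen, hmem, hreg⟩ := h0.exists_mvPolynomial (Nat.card κ)
  refine ⟨ss.map e.toRingEquiv, by simpa using hlen, ?_, hreg.map_ringEquiv e.toRingEquiv⟩
  intro s hs
  obtain ⟨t, ht, rfl⟩ := List.mem_map.mp hs
  suffices hle : Ideal.span (MvPolynomial.C '' {r | r ∈ rs.map (algebraMap A (MvPolynomial κ' A))} ∪
      Set.range MvPolynomial.X) ≤ J.comap e.toRingEquiv from hle (hmem t ht)
  rw [Ideal.span_le]
  rintro _ (⟨_, hr', rfl⟩ | ⟨i, rfl⟩)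
  · obtain ⟨r, hr, rfl⟩ := List.mem_map.mp hr'
    have : e (MvPolynomial.C (algebraMap A (MvPolynomial κ' A) r)) = MvPolynomial.C r :=
      e.commutes r
    change e (MvPolynomial.C (algebraMap A (MvPolynomial κ' A) r)) ∈ J
    rw [this]
    exact hJ r hr
  · change e₁ (e₂ (MvPolynomial.X i)) ∈ J
    have : e₂ (MvPolynomial.X i) = MvPolynomial.X (Sum.inl ((Finite.equivFin κ).symm i)) := by
      simp [e₂]
    rw [this, he₁]
    exact hJ' _

end LinearFormsRegular

/-! ### The grade estimate at a prime -/

section Core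

open RingTheory.Sequence Pointwise

/-- Let `zs` be a weakly regular sequence in `R[X₁, …, Xₙ]` and `q` a prime of `R`. If `q` contains
a weakly regular sequence `xs`, then no element of `R[X] ⧸ (zs)` with `R`-annihilator `q` is killed
by linear forms, independent over the residue field of `q`, whose number exceeds
`length zs - length xs`. -/
lemma not_isWeaklyRegular_of_colon_eq_prime {R : Type u} [CommRing R] (q : Ideal R) [q.IsPrime]
    {xs : List R} (hxq : ∀ x ∈ xs, x ∈ q) (hxs : IsWeaklyRegular R xs) {n : ℕ}
    {zs : List (MvPolynomial (Fin n) R)} (hzs : IsWeaklyRegular (MvPolynomial (Fin n) R) zs)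
    {κ : Type*} [Finite κ] (v : κ → Fin n → R)
    (hv : LinearIndependent q.ResidueField fun k => algebraMap R q.ResidueField ∘ v k)
    (hlt : zs.length < xs.length + Nat.card κ) (f : MvPolynomial (Fin n) R)
    (hf : ∀ r : R, MvPolynomial.C r * f ∈ Ideal.ofList zs ↔ r ∈ q)
    (hvf : ∀ k, linearForm R (v k) * f ∈ Ideal.ofList zs) : False := by
  let A := Localization.AtPrime q
  let B := MvPolynomial (Fin n) R
  let B' := MvPolynomial (Fin n) A
  let _ : Algebra B B' := MvPolynomial.algebraMvPolynomial
  have hloc : IsLocalization (q.primeCompl.map (MvPolynomial.C (σ := Fin n) (R := R))) B' :=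
    MvPolynomial.isLocalization q.primeCompl A
  have hmap : algebraMap B B' = MvPolynomial.map (algebraMap R A) := rfl
  have hzs' : IsWeaklyRegular B' (zs.map (algebraMap B B')) :=
    hzs.of_isLocalization B' (q.primeCompl.map (MvPolynomial.C (σ := Fin n) (R := R)))
  have hxs' : IsWeaklyRegular A (xs.map (algebraMap R A)) := hxs.of_isLocalization A q.primeCompl
  have hI : Ideal.ofList (zs.map (algebraMap B B')) = (Ideal.ofList zs).map (algebraMap B B') :=
    (Ideal.map_ofList _ _).symm
  let f' : B' := algebraMap B B' f
  -- This uses that the annihilator of `f` is no larger than `q`: no element outside `q` kills it.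
  have hf' : f' ∉ Ideal.ofList (zs.map (algebraMap B B')) := by
    rw [hI, IsLocalization.algebraMap_mem_map_algebraMap_iff
      (q.primeCompl.map (MvPolynomial.C (σ := Fin n) (R := R)))]
    rintro ⟨_, ⟨s, hs, rfl⟩, hsf⟩
    exact hs ((hf s).mp hsf)
  let J : Ideal B' := 
    Submodule.comap (LinearMap.mulRight B' f') (Ideal.ofList (zs.map (algebraMap B B')))
  have hJ : ∀ g : B', g ∈ J ↔ g * f' ∈ Ideal.ofList (zs.map (algebraMap B B')) := fun g => Iff.rfl
  obtain ⟨ss, hlen, hmem, hreg⟩ := hxs'.exists_mvPolynomial_linearForm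
    (fun k => algebraMap R A ∘ v k) hv J
    (fun r hr => by
      obtain ⟨x, hx, rfl⟩ := List.mem_map.mp hr
      rw [hJ, hI, ← MvPolynomial.map_C, ← hmap, ← map_mul]
      exact Ideal.mem_map_of_mem _ ((hf x).mpr (hxq x hx)))
    (fun k => by
      rw [hJ, hI, ← map_linearForm, ← hmap, ← map_mul]
      exact Ideal.mem_map_of_mem _ (hvf k))
  have htop : (Ideal.ofList (zs.map (algebraMap B B')) • ⊤ : Submodule B' B') =
      Ideal.ofList (zs.map (algebraMap B B')) := by
    rw [smul_eq_mul, Ideal.mul_top]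
  -- The colon ideal `J` contains a regular sequence longer than `zs`, yet kills the nonzero class
  -- of `f'`.
  have := eq_zero_of_isWeaklyRegular_of_length_lt hmem hreg hzs' (by simpa [hlen] using hlt)
    (m := Submodule.Quotient.mk f') (fun r hr => by
      rw [← Submodule.Quotient.mk_smul, Submodule.Quotient.mk_eq_zero, htop]
      exact (hJ r).mp hr)
  rw [Submodule.Quotient.mk_eq_zero, htop] at this
  exact hf' this

end Core

/-! ### Local generators and the rank of the relations -/

section Generators

/-- A spanning family of a localized module gives a family of the module whose span contains a
multiple of every element. -/
lemma LocalizedModule.exists_smul_mem_span_of_span_eq_top {R : Type*} [CommRing R]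
    (S : Submonoid R) {E : Type*} [AddCommGroup E] [Module R E] {m : ℕ}
    (G : Fin m → LocalizedModule S E)
    (hG : Submodule.span (Localization S) (Set.range G) = ⊤) :
    ∃ g : Fin m → E, ∀ x : E, ∃ s ∈ S, s • x ∈ Submodule.span R (Set.range g) := by
  have hsurj := fun j => IsLocalizedModule.mk'_surjective S (LocalizedModule.mkLinearMap S E) (G j)
  choose p hp using hsurj
  let g : Fin m → E := fun j => (p j).1
  have htop : (Submodule.span R (Set.range g)).localized' (Localization S) S
      (LocalizedModule.mkLinearMap S E) = ⊤ := by
    rw [eq_top_iff, ← hG, Submodule.span_le]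
    rintro _ ⟨j, rfl⟩
    rw [SetLike.mem_coe, Submodule.mem_localized']
    exact ⟨g j, Submodule.subset_span ⟨j, rfl⟩, (p j).2, hp j⟩
  refine ⟨g, fun x => ?_⟩
  have hx : LocalizedModule.mkLinearMap S E x ∈ (Submodule.span R (Set.range g)).localized'
      (Localization S) S (LocalizedModule.mkLinearMap S E) := htop ▸ Submodule.mem_top
  rw [Submodule.mem_localized'] at hx
  obtain ⟨y, hy, s, hs⟩ := hx
  rw [IsLocalizedModule.mk'_eq_iff] at hs
  rw [← LinearMap.map_smul_of_tower] at hs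
  obtain ⟨c, hc⟩ := (IsLocalizedModule.eq_iff_exists S (LocalizedModule.mkLinearMap S E)).mp hs
  refine ⟨c * s, S.mul_mem c.2 s.2, ?_⟩
  rw [mul_smul]
  have : (c : R) • (s : R) • x = (c : R) • y := hc.symm
  rw [this]
  exact Submodule.smul_mem _ _ hy

lemma exists_span_range_eq_top_of_minGenerators {R : Type*} [CommRing R] {E : Type*}
    [AddCommGroup E] [Module R E] [Module.Finite R E] {m : ℕ} (hm : minGenerators R E = m) :
    ∃ g : Fin m → E, Submodule.span R (Set.range g) = ⊤ := by
  obtain ⟨s, hcard, hs⟩ := (Module.Finite.fg_top (R := R) (M := E)).exists_span_finset_card_eq_spanFinrank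
  have hm' : s.card = m := by rw [hcard]; exact hm
  refine ⟨fun j => (s.equivFinOfCardEq hm').symm j, ?_⟩
  rw [← hs]
  congr 1
  ext x
  constructor
  · rintro ⟨j, rfl⟩
    exact ((s.equivFinOfCardEq hm').symm j).2
  · intro hx
    exact ⟨s.equivFinOfCardEq hm' ⟨x, hx⟩, by simp⟩

/-- If `E` has a presentation with `n` generators and relations `φ`, and is generated by `m`
elements locally at `q`, then at least `n - m` relations are independent over the residue field. -/
lemma exists_linearIndependent_residueField_of_relations {R : Type*} [CommRing R] {E : Type*}
    [AddCommGroup E] [Module R E] (q : Ideal R) [q.IsPrime] {n m : ℕ} {ι : Type u} [Finite ι]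
    (a : Fin n → E) (ha : Submodule.span R (Set.range a) = ⊤) (φ : ι → Fin n → R)
    (hφ : ∀ w : Fin n → R, ∑ i, w i • a i = 0 → w ∈ Submodule.span R (Set.range φ))
    (g : Fin m → E) (hg : ∀ x : E, ∃ s ∉ q, s • x ∈ Submodule.span R (Set.range g)) :
    ∃ (κ : Type u) (_ : Finite κ) (t : κ → ι), Function.Injective t ∧ n ≤ Nat.card κ + m ∧
      LinearIndependent q.ResidueField fun k => algebraMap R q.ResidueField ∘ φ (t k) := by
  classical
  let K := q.ResidueField
  let β : (Fin n → R) →ₗ[R] (Fin n → K) := (Algebra.linearMap R K).compLeft (Fin n)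
  have hβ : ∀ w, β w = algebraMap R K ∘ w := fun w => rfl
  choose γ hγ using fun j => (Submodule.mem_span_range_iff_exists_fun R).mp
    (ha ▸ Submodule.mem_top : g j ∈ Submodule.span R (Set.range a))
  let N := Submodule.span K (Set.range (β ∘ φ))
  let G := Submodule.span K (Set.range (β ∘ γ))
  have hN : ∀ w ∈ Submodule.span R (Set.range φ), β w ∈ N := fun w hw => by
    have hle : Submodule.span R (Set.range φ) ≤ (N.restrictScalars R).comap β := by
      rw [Submodule.span_le]
      rintro _ ⟨j, rfl⟩
      exact Submodule.subset_span ⟨j, rfl⟩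
    exact hle hw
  -- Some `s ∉ q` makes `s • a i` a combination of the `g j`; lifting to `Rⁿ` writes `s • eᵢ` as a
  -- relation plus a combination of the `γ j`. Comparing dimensions then bounds the rank of the
  -- relations.
  have htop : N ⊔ G = ⊤ := by
    rw [eq_top_iff, ← (Pi.basisFun K (Fin n)).span_eq, Submodule.span_le]
    rintro _ ⟨i, rfl⟩
    obtain ⟨s, hs, hsi⟩ := hg (a i)
    obtain ⟨c, hc⟩ := (Submodule.mem_span_range_iff_exists_fun R).mp hsi
    have h1 : s • Pi.single i (1 : R) - ∑ j, c j • γ j ∈ Submodule.span R (Set.range φ) := by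
      refine hφ _ ?_
      let L : (Fin n → R) →ₗ[R] E := Fintype.linearCombination R a
      change L (s • Pi.single i (1 : R) - ∑ j, c j • γ j) = 0
      have hL : ∀ j, L (γ j) = g j := hγ
      rw [map_sub, map_smul, map_sum]
      simp only [map_smul, hL, hc]
      simp [L, Fintype.linearCombination_apply_single]
    have h2 := hN _ h1
    have hsK : algebraMap R K s ≠ 0 := by
      rwa [Ne, Ideal.algebraMap_residueField_eq_zero]
    have h3 : algebraMap R K s • (Pi.basisFun K (Fin n) i) ∈ N ⊔ G := by
      have : algebraMap R K s • (Pi.basisFun K (Fin n) i) =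
          β (s • Pi.single i (1 : R) - ∑ j, c j • γ j) +
            ∑ j, algebraMap R K (c j) • β (γ j) := by
        rw [map_sub, map_smul, map_sum]
        simp only [map_smul, algebraMap_smul, sub_add_cancel]
        congr 1
        ext i'
        simp [hβ, Pi.single_apply, apply_ite]
      rw [this]
      refine Submodule.add_mem_sup h2 (Submodule.sum_mem _ fun j _ => ?_)
      exact Submodule.smul_mem _ _ (Submodule.subset_span ⟨j, rfl⟩)
    exact (Submodule.smul_mem_iff _ hsK).mp h3
  obtain ⟨κ, t, ht, hspan, hli⟩ := exists_linearIndependent' K (β ∘ φ)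
  have hκ : Finite κ := Finite.of_injective t ht
  refine ⟨κ, hκ, t, ht, ?_, hli⟩
  have := Fintype.ofFinite κ
  have h1 : Module.finrank K N = Nat.card κ := by
    have := finrank_span_eq_card hli
    rw [hspan] at this
    rw [Nat.card_eq_fintype_card]
    exact this
  have h2 : Module.finrank K G ≤ m := by
    exact (finrank_range_le_card (R := K) (β ∘ γ)).trans_eq (Fintype.card_fin m)
  have h3 := Submodule.finrank_add_le_finrank_add_finrank N G
  rw [htop, finrank_top, Module.finrank_fin_fun] at h3
  omega

end Generators

/-! ### Presentations of the symmetric algebra and their localization -/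

section SymmetricPresentation

variable {R : Type*} [CommRing R] {E : Type*} [AddCommGroup E] [Module R E] {n : ℕ}

lemma symPresentation_linearForm (a : Fin n → E) (w : Fin n → R) :
    symPresentation R a (linearForm R w) = SymmetricAlgebra.ι R E (∑ i, w i • a i) := by
  simp [linearForm, Fintype.linearCombination_apply, symPresentation]

lemma symPresentation_surjective (a : Fin n → E) (ha : Submodule.span R (Set.range a) = ⊤) :
    Function.Surjective (symPresentation R a) := by
  intro x
  induction x using SymmetricAlgebra.induction with
  | algebraMap r => exact ⟨MvPolynomial.C r, by simp [symPresentation]⟩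
  | ι x =>
    obtain ⟨w, rfl⟩ := (Submodule.mem_span_range_iff_exists_fun R).mp
      (ha ▸ Submodule.mem_top : x ∈ Submodule.span R (Set.range a))
    exact ⟨linearForm R w, symPresentation_linearForm a w⟩
  | mul x y hx hy =>
    obtain ⟨p, rfl⟩ := hx
    obtain ⟨q, rfl⟩ := hy
    exact ⟨p * q, map_mul _ _ _⟩
  | add x y hx hy =>
    obtain ⟨p, rfl⟩ := hx
    obtain ⟨q, rfl⟩ := hy
    exact ⟨p + q, map_add _ _ _⟩

/-- The defining ideal of the symmetric algebra is generated by the linear forms attached to a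
generating family of relations. -/
lemma symDefiningIdeal_eq_span {ι : Type*} (a : Fin n → E)
    (ha : Submodule.span R (Set.range a) = ⊤) (φ : ι → Fin n → R)
    (hφ : ∀ w : Fin n → R, ∑ i, w i • a i = 0 ↔ w ∈ Submodule.span R (Set.range φ)) :
    symDefiningIdeal R a = Ideal.span (Set.range fun j => linearForm R (φ j)) := by
  set I := Ideal.span (Set.range fun j => linearForm R (φ j)) with hI
  apply le_antisymm
  · let π : (Fin n → R) →ₗ[R] E := Fintype.linearCombination R a
    have hπ : Function.Surjective π := by
      rw [← LinearMap.range_eq_top, Fintype.range_linearCombination, ha]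
    let h : (Fin n → R) →ₗ[R] (MvPolynomial (Fin n) R ⧸ I) :=
      (Ideal.Quotient.mkₐ R I).toLinearMap ∘ₗ linearForm R
    have hle : LinearMap.ker π ≤ LinearMap.ker h := by
      intro w hw
      have hw' : w ∈ Submodule.span R (Set.range φ) := (hφ w).mp hw
      refine (Submodule.span_le.mpr ?_) hw'
      rintro _ ⟨j, rfl⟩
      exact Ideal.Quotient.eq_zero_iff_mem.mpr (Ideal.subset_span ⟨j, rfl⟩)
    -- Relations vanish modulo `I`, so `aᵢ ↦ Xᵢ` is well defined on `E`; its extension to the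
    -- symmetric algebra recovers the quotient map by `I`, whence the kernel lies in `I`.
    let g : E →ₗ[R] (MvPolynomial (Fin n) R ⧸ I) :=
      (LinearMap.ker π).liftQ h hle ∘ₗ (π.quotKerEquivOfSurjective hπ).symm.toLinearMap
    have hg : ∀ i, g (a i) = Ideal.Quotient.mk I (MvPolynomial.X i) := fun i => by
      have h1 : (π.quotKerEquivOfSurjective hπ).symm (a i) =
          Submodule.Quotient.mk (Pi.single i 1) := by
        rw [LinearEquiv.symm_apply_eq, LinearMap.quotKerEquivOfSurjective_apply_mk]
        simp [π, Fintype.linearCombination_apply_single]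
      simp only [g, LinearMap.comp_apply, LinearEquiv.coe_coe, h1]
      change Ideal.Quotient.mk I (linearForm R (Pi.single i 1)) = _
      simp [linearForm, Fintype.linearCombination_apply_single]
    have hcomp : (SymmetricAlgebra.lift g).comp (symPresentation R a) =
        Ideal.Quotient.mkₐ R I := by
      refine MvPolynomial.algHom_ext fun i => ?_
      simp [symPresentation, hg]
    intro p hp
    rw [← Ideal.Quotient.eq_zero_iff_mem, ← Ideal.Quotient.mkₐ_eq_mk R, ← hcomp,
      AlgHom.comp_apply, show symPresentation R a p = 0 from hp, map_zero]
  · rw [Ideal.span_le]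
    rintro _ ⟨j, rfl⟩
    change symPresentation R a (linearForm R (φ j)) = 0
    rw [symPresentation_linearForm, (hφ (φ j)).mpr (Submodule.subset_span ⟨j, rfl⟩), map_zero]

/-- Presentations of modules localize. -/
lemma LocalizedModule.sum_smul_eq_zero_iff {ι : Type*} (S : Submonoid R) (a : Fin n → E)
    (φ : ι → Fin n → R)
    (hφ : ∀ w : Fin n → R, ∑ i, w i • a i = 0 ↔ w ∈ Submodule.span R (Set.range φ))
    (w : Fin n → Localization S) :
    ∑ i, w i • LocalizedModule.mkLinearMap S E (a i) = 0 ↔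
      w ∈ Submodule.span (Localization S)
        (Set.range fun j => algebraMap R (Localization S) ∘ φ j) := by
  constructor
  · intro hw
    obtain ⟨s, hs⟩ := IsLocalization.exist_integer_multiples_of_finite S w
    choose r hr using hs
    have h1 : LocalizedModule.mkLinearMap S E (∑ i, r i • a i) = 0 := by
      have h2 : ∀ i, LocalizedModule.mkLinearMap S E (r i • a i) =
          (s : R) • w i • LocalizedModule.mkLinearMap S E (a i) := fun i => by
        rw [map_smul, ← algebraMap_smul (Localization S) (r i), hr, smul_assoc]
      rw [map_sum, Finset.sum_congr rfl fun i _ => h2 i, ← Finset.smul_sum, hw, smul_zero]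
    obtain ⟨t, ht⟩ := (IsLocalizedModule.eq_zero_iff S (LocalizedModule.mkLinearMap S E)).mp h1
    have h3 : (t : R) • r ∈ Submodule.span R (Set.range φ) := by
      rw [← hφ]
      have : (t : R) • ∑ i, r i • a i = 0 := ht
      rw [Finset.smul_sum] at this
      simpa [mul_smul] using this
    let β : (Fin n → R) →ₗ[R] (Fin n → Localization S) :=
      (Algebra.linearMap R (Localization S)).compLeft (Fin n)
    have hle : Submodule.span R (Set.range φ) ≤ ((Submodule.span (Localization S)
        (Set.range fun j => algebraMap R (Localization S) ∘ φ j)).restrictScalars R).comap β := by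
      rw [Submodule.span_le]
      rintro _ ⟨j, rfl⟩
      exact Submodule.subset_span ⟨j, rfl⟩
    have h4 : algebraMap R (Localization S) (t * s : S) • w = β ((t : R) • r) := by
      ext i
      have := hr i
      simp only [Algebra.smul_def] at this
      simp [β, this, mul_assoc]
    have h5 := IsLocalization.map_units (Localization S) (t * s)
    rw [← Submodule.smul_mem_iff_of_isUnit _ h5, h4]
    exact hle h3
  · intro hw
    let L : (Fin n → Localization S) →ₗ[Localization S] LocalizedModule S E :=
      Fintype.linearCombination (Localization S) fun i => LocalizedModule.mkLinearMap S E (a i)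
    suffices hle : Submodule.span (Localization S)
        (Set.range fun j => algebraMap R (Localization S) ∘ φ j) ≤ LinearMap.ker L from hle hw
    rw [Submodule.span_le]
    rintro _ ⟨j, rfl⟩
    rw [SetLike.mem_coe, LinearMap.mem_ker]
    have h1 := (hφ (φ j)).mpr (Submodule.subset_span ⟨j, rfl⟩)
    have h2 := congrArg (LocalizedModule.mkLinearMap S E) h1
    rw [map_zero, map_sum] at h2
    rw [← h2]
    simp [L, Fintype.linearCombination_apply]

lemma LocalizedModule.span_range_mkLinearMap_eq_top (S : Submonoid R) (a : Fin n → E)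
    (ha : Submodule.span R (Set.range a) = ⊤) :
    Submodule.span (Localization S) (Set.range fun i => LocalizedModule.mkLinearMap S E (a i)) =
      ⊤ := by
  have := Submodule.localized'_span (Localization S) S (LocalizedModule.mkLinearMap S E)
    (Set.range a)
  rw [ha, Submodule.localized'_top, ← Set.range_comp] at this
  exact this.symm

end SymmetricPresentation

/-! ### Freeness and rank of the relation module -/

section Resolution

open CategoryTheory

/-- A module with projective dimension at most one over a Noetherian local ring: its relation
modules are free. -/
lemma Module.Free.ker_of_projectiveDimension_le_one {R : Type u} [CommRing R] [IsLocalRing R]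
    [IsNoetherianRing R] {F E : Type u} [AddCommGroup E] [Module R E] [AddCommGroup F] [Module R F]
    [Module.Finite R F] [Module.Projective R F] (π : F →ₗ[R] E) (hπ : Function.Surjective π)
    (hpd : projectiveDimension (ModuleCat.of R E) ≤ 1) : Module.Free R (LinearMap.ker π) := by
  let S : ShortComplex (ModuleCat.{u} R) :=
    ShortComplex.mk (ModuleCat.ofHom (LinearMap.ker π).subtype) (ModuleCat.ofHom π) (by
      ext x
      exact x.2)
  have hS : S.ShortExact :=
    { exact := (ShortComplex.ShortExact.moduleCat_exact_iff_function_exact S).mpr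
        (LinearMap.exact_subtype_ker_map π)
      mono_f := (ModuleCat.mono_iff_injective _).mpr Subtype.val_injective
      epi_g := (ModuleCat.epi_iff_surjective _).mpr hπ }
  have h2 : CategoryTheory.Projective S.X₂ :=
    (IsProjective.iff_projective (R := R) F).mp inferInstance
  have h3 : HasProjectiveDimensionLT S.X₃ 2 := by
    have := (projectiveDimension_le_iff (ModuleCat.of R E) 1).mp (by exact_mod_cast hpd)
    exact this
  have h1 := (hS.hasProjectiveDimensionLT_X₃_iff 0 h2).mp h3
  have h4 : CategoryTheory.Projective S.X₁ := projective_iff_hasProjectiveDimensionLT_one.mpr h1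
  have : Module.Projective R (LinearMap.ker π) :=
    (IsProjective.iff_projective (R := R) (LinearMap.ker π)).mpr h4
  exact Module.free_of_flat_of_isLocalRing

/-- Over the total ring of fractions `E` becomes free, so the presentation splits there and ranks
add; ranks of free modules are unchanged by this localization. -/
lemma finrank_ker_add_of_hasModuleRank {R : Type*} [CommRing R] [Nontrivial R]
    {F E : Type*} [AddCommGroup E] [Module R E] [AddCommGroup F] [Module R F]
    [Module.Finite R F] [Module.Free R F] (π : F →ₗ[R] E) (hπ : Function.Surjective π)
    [Module.Free R (LinearMap.ker π)] [Module.Finite R (LinearMap.ker π)] {e : ℕ}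
    (he : HasModuleRank R E e) :
    Module.finrank R (LinearMap.ker π) + e = Module.finrank R F := by
  obtain ⟨ε⟩ := he
  let Q := Localization R⁰
  have : Nontrivial Q := (IsLocalization.injective Q (le_refl R⁰)).nontrivial
  let f : LocalizedModule R⁰ (LinearMap.ker π) →ₗ[Q] LocalizedModule R⁰ F :=
    LocalizedModule.map R⁰ (LinearMap.ker π).subtype
  let g : LocalizedModule R⁰ F →ₗ[Q] LocalizedModule R⁰ E := LocalizedModule.map R⁰ π
  have hf : Function.Injective f :=
    LocalizedModule.map_injective R⁰ _ Subtype.val_injective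
  have hg : Function.Surjective g := LocalizedModule.map_surjective R⁰ _ hπ
  have hex : Function.Exact f g :=
    LocalizedModule.map_exact R⁰ _ _ (LinearMap.exact_subtype_ker_map π)
  have hfree : Module.Free Q (LocalizedModule R⁰ E) := Module.Free.of_equiv ε.symm
  have hfree' : Module.Free Q (LocalizedModule R⁰ (LinearMap.ker π)) :=
    Module.free_of_isLocalizedModule R⁰ (LocalizedModule.mkLinearMap R⁰ (LinearMap.ker π))
  have hfin : Module.Finite Q (LocalizedModule R⁰ E) := Module.Finite.equiv ε.symm
  obtain ⟨l, hl⟩ := Module.projective_lifting_property g LinearMap.id hg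
  let eqv := (hex.splitSurjectiveEquiv hf ⟨l, hl⟩).1
  have h1 := eqv.finrank_eq
  have h2 := Module.finrank_of_isLocalizedModule_of_free Q R⁰ (LocalizedModule.mkLinearMap R⁰ F)
  have h3 := Module.finrank_of_isLocalizedModule_of_free Q R⁰
    (LocalizedModule.mkLinearMap R⁰ (LinearMap.ker π))
  rw [Module.finrank_prod, h2, h3, ε.finrank_eq, Module.finrank_fin_fun] at h1
  exact h1.symm

end Resolution

/-! ### Regularity of the linear forms and associated primes of the quotient -/

section LinearFormSequence

open RingTheory.Sequence

variable {R : Type u} [CommRing R] {d n : ℕ}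

/-- The sequence of linear forms attached to a family of vectors. -/
noncomputable def linearForms (φ : Fin d → Fin n → R) : List (MvPolynomial (Fin n) R) :=
  List.ofFn fun j => linearForm R (φ j)

@[simp]
lemma length_linearForms (φ : Fin d → Fin n → R) : (linearForms φ).length = d := by
  simp [linearForms]

lemma ofList_linearForms (φ : Fin d → Fin n → R) :
    Ideal.ofList (linearForms φ) = Ideal.span (Set.range fun j => linearForm R (φ j)) := by
  simp only [Ideal.ofList, linearForms, List.mem_ofFn]
  rfl

lemma linearForm_mem_ofList_take (φ : Fin d → Fin n → R) (i : Fin d) {j : ℕ} (hij : (i : ℕ) < j) :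
    linearForm R (φ i) ∈ Ideal.ofList ((linearForms φ).take j) := by
  refine Ideal.subset_span ?_
  rw [Set.mem_ofPred_eq, List.mem_take_iff_getElem]
  exact ⟨i, by simp [hij], by simp [linearForms]⟩

/-- The relations `φ` have large rank at all primes: at a prime `q` of height `h` at least
`d - h` of them are independent over the residue field, and at least `d + 1 - h` if `q` is neither
minimal nor maximal. -/
def HasLargeRank [IsLocalRing R] (φ : Fin d → Fin n → R) : Prop :=
  ∀ (q : Ideal R) [q.IsPrime], ∃ (h : ℕ) (κ : Type) (_ : Finite κ) (t : κ → Fin d),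
    q.height = h ∧ Function.Injective t ∧ d ≤ h + Nat.card κ ∧
    (h ≠ 0 → q ≠ IsLocalRing.maximalIdeal R → d + 1 ≤ h + Nat.card κ) ∧
    LinearIndependent q.ResidueField fun k => algebraMap R q.ResidueField ∘ φ (t k)

/-- Only `d - (j + 1)` indices lie beyond `j`, so keeping the first `j + 1` forms loses at most that
many independent ones. -/
lemma Function.Injective.card_le_card_subtype_le_add {κ : Type*} [Finite κ] {t : κ → Fin d}
    (ht : Function.Injective t) {j : ℕ} (hj : j < d) :
    Nat.card κ ≤ Nat.card {k // (t k : ℕ) ≤ j} + (d - (j + 1)) := by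
  classical
  have := Fintype.ofFinite κ
  have h1 : Nat.card κ = Nat.card {k // (t k : ℕ) ≤ j} + Nat.card {k // ¬ (t k : ℕ) ≤ j} := by
    rw [← Nat.card_sum]
    exact Nat.card_congr (Equiv.sumCompl _).symm
  have h2 : Nat.card {k // ¬ (t k : ℕ) ≤ j} ≤ Nat.card (Finset.Ioi (⟨j, hj⟩ : Fin d)) := by
    refine Nat.card_le_card_of_injective
      (fun k => ⟨t k.1, by simpa [Fin.lt_def] using k.2⟩) fun k k' hkk => ?_
    exact Subtype.ext (ht (congrArg Subtype.val hkk))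
  rw [Nat.card_eq_fintype_card (α := Finset.Ioi _), Fintype.card_coe, Fin.card_Ioi] at h2
  dsimp only at h2
  omega

/-- If the next form were a zerodivisor, an associated prime `q` over `R` of the kernel of
multiplication by it would violate the grade estimate. -/
lemma HasLargeRank.isWeaklyRegular_take [IsLocalRing R] {φ : Fin d → Fin n → R}
    (hφ : HasLargeRank φ) (hR : IsCohenMacaulayLocalRing R) (j : ℕ) (hj : j ≤ d) :
    IsWeaklyRegular (MvPolynomial (Fin n) R) ((linearForms φ).take j) := by
  induction j with
  | zero => simp
  | succ j ih =>
    have := hR.1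
    have hj' : j < (linearForms φ).length := by simpa using hj
    have ih := ih (by omega)
    rw [List.take_add_one, List.getElem?_eq_getElem hj', Option.toList_some,
      isWeaklyRegular_append_iff, isWeaklyRegular_singleton_iff]
    refine ⟨ih, ?_⟩
    have htop : (Ideal.ofList ((linearForms φ).take j) • ⊤ :
        Submodule (MvPolynomial (Fin n) R) (MvPolynomial (Fin n) R)) =
        Ideal.ofList ((linearForms φ).take j) := by
      rw [smul_eq_mul, Ideal.mul_top]
    rw [htop]
    set I := Ideal.ofList ((linearForms φ).take j)
    have hget : (linearForms φ)[j] = linearForm R (φ ⟨j, hj⟩) := by simp [linearForms]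
    rw [hget]
    set l := linearForm R (φ ⟨j, hj⟩)
    let N : Submodule R (MvPolynomial (Fin n) R ⧸ I) :=
      LinearMap.ker (LinearMap.mulLeft R (Ideal.Quotient.mk I l))
    rw [isSMulRegular_iff_right_eq_zero_of_smul]
    by_contra! hcon
    obtain ⟨x, hx, hx0⟩ := hcon
    have hxN : x ∈ N := hx
    obtain ⟨q, hq, -⟩ := exists_le_isAssociatedPrime_of_isNoetherianRing R (⟨x, hxN⟩ : N)
      (fun h => hx0 (congrArg Subtype.val h))
    obtain ⟨hqp, ⟨y, hyN⟩, hy⟩ := isAssociatedPrime_iff.mp hq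
    obtain ⟨f, rfl⟩ := Ideal.Quotient.mk_surjective y
    obtain ⟨h, κ, _, t, hh, ht, hcard, -, hli⟩ := hφ q
    obtain ⟨xs, hlen, hmem, hreg⟩ := hR.exists_isWeaklyRegular_mem_prime q h hh
    refine not_isWeaklyRegular_of_colon_eq_prime q hmem hreg ih
      (fun k : {k // (t k : ℕ) ≤ j} => φ (t k)) (hli.comp _ Subtype.val_injective) ?_ f ?_ ?_
    -- At least `(d - h) - (d - (j + 1))` independent forms of index at most `j` remain; with the
    -- `h` elements of `q` this makes at least `j + 1`, one more than the `j` forms divided out.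
    · have := ht.card_le_card_subtype_le_add hj
      rw [List.length_take, hlen]
      omega
    · intro r
      rw [hy, Submodule.mem_colon_singleton, Submodule.mem_bot, ← Ideal.Quotient.eq_zero_iff_mem,
        Subtype.ext_iff, ← MvPolynomial.smul_eq_C_mul]
      rfl
    · rintro ⟨k, hk⟩
      rcases hk.lt_or_eq with hk | hk
      · exact Ideal.mul_mem_right _ _ (linearForm_mem_ofList_take φ (t k) hk)
      · have hl : linearForm R (φ (t k)) = l := by
          simp only [l]
          congr 2
          exact Fin.ext hk
        simp only [hl]
        rw [← Ideal.Quotient.eq_zero_iff_mem, map_mul]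
        exact hyN

lemma HasLargeRank.isWeaklyRegular [IsLocalRing R] {φ : Fin d → Fin n → R}
    (hφ : HasLargeRank φ) (hR : IsCohenMacaulayLocalRing R) :
    IsWeaklyRegular (MvPolynomial (Fin n) R) (linearForms φ) := by
  have := hφ.isWeaklyRegular_take hR d le_rfl
  rwa [List.take_of_length_le (by simp)] at this

/-- The `R`-module `R[X] ⧸ (linear forms)` has only minimal primes and the maximal ideal as
possible associated primes. -/
lemma HasLargeRank.mem_minimalPrimes_of_isAssociatedPrime [IsLocalRing R] {φ : Fin d → Fin n → R}
    (hφ : HasLargeRank φ) (hR : IsCohenMacaulayLocalRing R) (q : Ideal R)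
    (hq : IsAssociatedPrime q (MvPolynomial (Fin n) R ⧸ Ideal.ofList (linearForms φ)))
    (hqm : q ≠ IsLocalRing.maximalIdeal R) : q ∈ minimalPrimes R := by
  have := hR.1
  obtain ⟨hqp, y, hy⟩ := isAssociatedPrime_iff.mp hq
  obtain ⟨f, rfl⟩ := Ideal.Quotient.mk_surjective y
  obtain ⟨h, κ, _, t, hh, ht, -, hcard, hli⟩ := hφ q
  by_contra hmin
  have h0 : h ≠ 0 := by
    rintro rfl
    exact hmin (Ideal.height_eq_zero_iff.mp hh)
  obtain ⟨xs, hlen, hmem, hreg⟩ := hR.exists_isWeaklyRegular_mem_prime q h hh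
  -- All `d` forms vanish in the quotient, so the stronger bound yields `h + (d + 1 - h) > d`.
  refine not_isWeaklyRegular_of_colon_eq_prime q hmem hreg (hφ.isWeaklyRegular hR)
    (fun k => φ (t k)) hli ?_ f ?_ ?_
  · have := hcard h0 hqm
    rw [length_linearForms, hlen]
    omega
  · intro r
    rw [hy, Submodule.mem_colon_singleton, Submodule.mem_bot, ← Ideal.Quotient.eq_zero_iff_mem,
      ← MvPolynomial.smul_eq_C_mul]
    rfl
  · intro k
    refine Ideal.mul_mem_right _ _ ?_
    rw [ofList_linearForms]
    exact Ideal.subset_span ⟨t k, rfl⟩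

end LinearFormSequence

/-! ### Rank bounds from `G_d` -/

section Relations

variable {R : Type u} [CommRing R] [IsLocalRing R] {E : Type u} [AddCommGroup E] [Module R E]
  {d e : ℕ}

/-- A module of rank `e` and projective dimension at most one generated by `d + e` elements has
`d` relations. -/
lemma exists_relations [IsNoetherianRing R] (hrank : HasModuleRank R E e)
    (hpd : CategoryTheory.projectiveDimension (ModuleCat.of R E) ≤ 1)
    (a : Fin (d + e) → E) (ha : Submodule.span R (Set.range a) = ⊤) :
    ∃ φ : Fin d → Fin (d + e) → R,
      ∀ w : Fin (d + e) → R, ∑ i, w i • a i = 0 ↔ w ∈ Submodule.span R (Set.range φ) := by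
  let π : (Fin (d + e) → R) →ₗ[R] E := Fintype.linearCombination R a
  have hπ : Function.Surjective π := by
    rw [← LinearMap.range_eq_top, Fintype.range_linearCombination, ha]
  have hfree := Module.Free.ker_of_projectiveDimension_le_one π hπ hpd
  have hfr := finrank_ker_add_of_hasModuleRank π hπ hrank
  rw [Module.finrank_fin_fun, add_left_inj] at hfr
  let b := Module.finBasisOfFinrankEq R (LinearMap.ker π) hfr
  refine ⟨fun j => (b j : Fin (d + e) → R), fun w => ?_⟩
  have hspan : Submodule.span R (Set.range fun j => (b j : Fin (d + e) → R)) =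
      LinearMap.ker π := by
    have := congrArg (Submodule.map (LinearMap.ker π).subtype) b.span_eq
    rw [Submodule.map_span, ← Set.range_comp, Submodule.map_top, Submodule.range_subtype] at this
    exact this
  rw [hspan]
  rfl

/-- The rank of the relations at `q` is at least `d + e` minus any number of local generators at
`q`: `e` of them suffice at a minimal prime, and `h + e - 1` in intermediate heights. -/
lemma hasLargeRank_of_satisfiesG [IsNoetherianRing R] [Module.Finite R E]
    (hd : ringKrullDim R = d) (hrank : HasModuleRank R E e) (hG : SatisfiesG R E e d)
    (a : Fin (d + e) → E) (ha : Submodule.span R (Set.range a) = ⊤)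
    (φ : Fin d → Fin (d + e) → R)
    (hφ : ∀ w : Fin (d + e) → R, ∑ i, w i • a i = 0 ↔ w ∈ Submodule.span R (Set.range φ)) :
    HasLargeRank φ := by
  intro q _
  have hmax : (IsLocalRing.maximalIdeal R).height = d := by
    have := IsLocalRing.maximalIdeal_height_eq_ringKrullDim (R := R)
    rw [hd] at this
    exact_mod_cast this
  by_cases hqm : q = IsLocalRing.maximalIdeal R
  · subst hqm
    -- The height is `d` here, so the empty family meets the bound.
    exact ⟨d, Fin 0, inferInstance, Fin.elim0, hmax, fun i => i.elim0, by simp,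
      fun _ h => (h rfl).elim, linearIndependent_empty_type⟩
  obtain ⟨h, hh⟩ := ENat.ne_top_iff_exists.mp (Ideal.height_ne_top_of_isPrime (I := q))
  have hlt : q < IsLocalRing.maximalIdeal R :=
    lt_of_le_of_ne (IsLocalRing.le_maximalIdeal (Ideal.IsPrime.ne_top ‹_›)) hqm
  have hhd : h + 1 ≤ d := by
    have := Ideal.height_add_one_le_of_lt_of_isPrime hlt
    rw [hmax, ← hh] at this
    exact_mod_cast this
  obtain ⟨m, g, hg, hm, hm'⟩ : ∃ (m : ℕ) (g : Fin m → E),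
      (∀ x : E, ∃ s ∉ q, s • x ∈ Submodule.span R (Set.range g)) ∧
      m ≤ h + e ∧ (h ≠ 0 → m + 1 ≤ h + e) := by
    rcases Nat.eq_zero_or_pos h with rfl | hpos
    -- Nonzerodivisors avoid the minimal prime `q`, so a basis over the total ring of fractions
    -- supplies `e` generators locally at `q`.
    · obtain ⟨ε⟩ := hrank
      obtain ⟨g, hg⟩ := LocalizedModule.exists_smul_mem_span_of_span_eq_top R⁰
        (fun j => ε.symm (Pi.basisFun (Localization R⁰) (Fin e) j)) (by
          have := congrArg (Submodule.map ε.symm.toLinearMap)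
            (Pi.basisFun (Localization R⁰) (Fin e)).span_eq
          rw [Submodule.map_span, ← Set.range_comp, Submodule.map_top,
            LinearEquiv.range] at this
          exact this)
      refine ⟨e, g, fun x => ?_, by simp, by simp⟩
      obtain ⟨s, hs, hsx⟩ := hg x
      refine ⟨s, fun hsq => ?_, hsx⟩
      have hmin : q ∈ minimalPrimes R := Ideal.height_eq_zero_iff.mp hh.symm
      exact Set.disjoint_left.mp (Ideal.disjoint_nonZeroDivisors_of_mem_minimalPrimes hmin) hsq hs
    · have hdim : ringKrullDim (Localization.AtPrime q) = h := by
        rw [IsLocalization.AtPrime.ringKrullDim_eq_height q, ← hh]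
        rfl
      have h1 := hG q h hdim hpos hhd
      obtain ⟨G, hG'⟩ := exists_span_range_eq_top_of_minGenerators
        (R := Localization.AtPrime q) (E := LocalizedModule q.primeCompl E) rfl
      obtain ⟨g, hg⟩ := LocalizedModule.exists_smul_mem_span_of_span_eq_top q.primeCompl G hG'
      exact ⟨_, g, hg, by omega, fun _ => h1⟩
  obtain ⟨κ, hκ, t, ht, hcard, hli⟩ :=
    exists_linearIndependent_residueField_of_relations q a ha φ (fun w => (hφ w).mp) g hg
  exact ⟨h, κ, hκ, t, hh.symm, ht, by omega, fun h0 _ => by have := hm' h0; omega, hli⟩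

end Relations

/-! ### Torsion and associated primes -/

section Torsion

variable {R : Type*} [CommRing R] {M : Type*} [AddCommGroup M] [Module R M]

lemma isAssociatedPrime_of_mem_minimalPrimes_torsionOf [IsNoetherianRing R] (x : M) {q : Ideal R}
    (hq : q ∈ (Ideal.torsionOf R M x).minimalPrimes) : IsAssociatedPrime q M := by
  have h1 : Module.annihilator R (Submodule.span R {x}) = Ideal.torsionOf R M x := by
    ext r
    rw [Submodule.mem_annihilator_span_singleton, Ideal.mem_torsionOf_iff]
  have h2 : q ∈ associatedPrimes R (Submodule.span R {x}) :=
    Module.associatedPrimes.minimalPrimes_annihilator_subset_associatedPrimes R _ (h1 ▸ hq)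
  exact IsAssociatedPrime.map_of_injective (Submodule.subtype _) h2 Subtype.val_injective

/-- If the associated primes of `M` are minimal or maximal, then torsion elements are killed by a
power of the maximal ideal. -/
lemma exists_pow_smul_eq_zero_of_torsion [IsNoetherianRing R] [IsLocalRing R]
    (hM : ∀ q : Ideal R, IsAssociatedPrime q M → q ≠ IsLocalRing.maximalIdeal R →
      q ∈ minimalPrimes R) {x : M} {r : R} (hr : r ∈ R⁰) (hrx : r • x = 0) :
    ∃ n : ℕ, ∀ s ∈ IsLocalRing.maximalIdeal R ^ n, s • x = 0 := by
  have hle : IsLocalRing.maximalIdeal R ≤ (Ideal.torsionOf R M x).radical := by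
    rw [← Ideal.sInf_minimalPrimes]
    refine le_sInf fun q hq => ?_
    by_cases hqm : q = IsLocalRing.maximalIdeal R
    · exact hqm.ge
    · have hmin := hM q (isAssociatedPrime_of_mem_minimalPrimes_torsionOf x hq) hqm
      exact (Set.disjoint_left.mp (Ideal.disjoint_nonZeroDivisors_of_mem_minimalPrimes hmin)
        (hq.1.2 ((Ideal.mem_torsionOf_iff x r).mpr hrx)) hr).elim
  obtain ⟨n, hn⟩ := Ideal.exists_pow_le_of_le_radical_of_fg hle (IsNoetherian.noetherian _)
  exact ⟨n, fun s hs => (Ideal.mem_torsionOf_iff x s).mp (hn hs)⟩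

/-- If the associated primes of `M` contained in `p` are minimal, then an element of `M` killed
by a nonzerodivisor of `R_p` vanishes in `M_p`. -/
lemma exists_notMem_smul_eq_zero_of_smul_eq_zero [IsNoetherianRing R] (p : Ideal R) [p.IsPrime]
    (hM : ∀ q : Ideal R, IsAssociatedPrime q M → q ≤ p → q ∈ minimalPrimes R) {x : M} {r u : R}
    (hr : algebraMap R (Localization.AtPrime p) r ∈ (Localization.AtPrime p)⁰) (hu : u ∉ p)
    (hrx : (u * r) • x = 0) : ∃ s ∉ p, s • x = 0 := by
  by_contra! hcon
  have hle : Ideal.torsionOf R M x ≤ p := fun s hs => by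
    by_contra hsp
    exact hcon s hsp ((Ideal.mem_torsionOf_iff x s).mp hs)
  obtain ⟨q, hq, hqp⟩ := Ideal.exists_minimalPrimes_le hle
  have hmin := hM q (isAssociatedPrime_of_mem_minimalPrimes_torsionOf x hq) hqp
  have hqprime : q.IsPrime := hmin.1.1
  have hrq : r ∈ q := (hqprime.mem_or_mem (hq.1.2 ((Ideal.mem_torsionOf_iff x _).mpr hrx))).resolve_left
    fun h => hu (hqp h)
  have hdisj : Disjoint (p.primeCompl : Set R) (q : Set R) :=
    Set.disjoint_left.mpr fun s hs hsq => hs (hqp hsq)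
  -- Only the image of `r` in `R_p` is a nonzerodivisor, so the contradiction is sought there: `q`
  -- extends to a minimal prime of `R_p` containing that image.
  have hheight := IsLocalization.height_map_of_disjoint (S := Localization.AtPrime p)
    p.primeCompl q hdisj
  rw [Ideal.height_eq_zero_iff.mpr hmin] at hheight
  have hprime : (q.map (algebraMap R (Localization.AtPrime p))).IsPrime :=
    IsLocalization.isPrime_of_isPrime_disjoint p.primeCompl _ q hqprime hdisj
  exact Set.disjoint_left.mp (Ideal.disjoint_nonZeroDivisors_of_mem_minimalPrimes
    (Ideal.height_eq_zero_iff.mp hheight)) (Ideal.mem_map_of_mem _ hrq) hr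

end Torsion

/-! ### Rees algebras: localization and saturation -/

section Rees

variable {R : Type u} [CommRing R]

lemma mem_reesTorsionIdeal_iff {E : Type*} [AddCommGroup E] [Module R E]
    {x : SymmetricAlgebra R E} : x ∈ reesTorsionIdeal R E ↔ ∃ r ∈ R⁰, r • x = 0 := by
  constructor
  · rintro ⟨r, hr⟩
    exact ⟨r, r.2, hr⟩
  · rintro ⟨r, hr, hx⟩
    exact ⟨⟨r, hr⟩, hx⟩

lemma isOfLinearType_of_reesTorsionIdeal_eq_bot {E : Type*} [AddCommGroup E] [Module R E]
    (h : reesTorsionIdeal R E = ⊥) : IsOfLinearType R E := by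
  refine ⟨?_, Ideal.Quotient.mk_surjective⟩
  rw [show (⇑(Ideal.Quotient.mkₐ R (reesTorsionIdeal R E)) :
    SymmetricAlgebra R E → ModuleReesAlgebra R E) = Ideal.Quotient.mk (reesTorsionIdeal R E) from rfl,
    RingHom.injective_iff_ker_eq_bot, Ideal.mk_ker, h]

/-- If the associated primes of the symmetric algebra contained in `p` are minimal, then `E_p` is of
linear type. -/
lemma isOfLinearType_localizedModule [IsNoetherianRing R] {E : Type*} [AddCommGroup E] [Module R E]
    {n : ℕ} {ι : Type*} (a : Fin n → E) (ha : Submodule.span R (Set.range a) = ⊤)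
    (φ : ι → Fin n → R)
    (hφ : ∀ w : Fin n → R, ∑ i, w i • a i = 0 ↔ w ∈ Submodule.span R (Set.range φ))
    (p : Ideal R) [p.IsPrime]
    (hAss : ∀ q : Ideal R, IsAssociatedPrime q (SymmetricAlgebra R E) → q ≤ p →
      q ∈ minimalPrimes R) :
    IsOfLinearType (Localization.AtPrime p) (LocalizedModule p.primeCompl E) := by
  refine isOfLinearType_of_reesTorsionIdeal_eq_bot ?_
  rw [eq_bot_iff]
  intro x hx
  rw [Ideal.mem_bot]
  obtain ⟨α, hα, hαx⟩ := mem_reesTorsionIdeal_iff.mp hx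
  let A := Localization.AtPrime p
  let B := MvPolynomial (Fin n) R
  let B' := MvPolynomial (Fin n) A
  let _ : Algebra B B' := MvPolynomial.algebraMvPolynomial
  have hloc : IsLocalization (p.primeCompl.map (MvPolynomial.C (σ := Fin n) (R := R))) B' :=
    MvPolynomial.isLocalization p.primeCompl A
  have hmap : algebraMap B B' = MvPolynomial.map (algebraMap R A) := rfl
  let a' : Fin n → LocalizedModule p.primeCompl E :=
    fun i => LocalizedModule.mkLinearMap p.primeCompl E (a i)
  have ha' : Submodule.span A (Set.range a') = ⊤ :=
    LocalizedModule.span_range_mkLinearMap_eq_top p.primeCompl a ha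
  obtain ⟨F, rfl⟩ := symPresentation_surjective a' ha' x
  have hI := symDefiningIdeal_eq_span a ha φ hφ
  have hI' : symDefiningIdeal A a' = (symDefiningIdeal R a).map (algebraMap B B') := by
    rw [hI, symDefiningIdeal_eq_span a' ha' _
      (LocalizedModule.sum_smul_eq_zero_iff p.primeCompl a φ hφ), Ideal.map_span, ← Set.range_comp]
    congr 2
    ext j : 1
    rw [Function.comp_apply, hmap, map_linearForm]
  -- Denominators of `F` and of the torsion multiplier `α` are cleared, turning `αF ∈ ℒ_p` into a
  -- statement about `r` and `f` over `R`.
  obtain ⟨⟨f, _, s, hs, rfl⟩, hf⟩ := IsLocalization.surj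
    (p.primeCompl.map (MvPolynomial.C (σ := Fin n) (R := R))) F
  obtain ⟨⟨r, t⟩, hrt⟩ := IsLocalization.surj p.primeCompl α
  simp only at hf hrt
  have hr : algebraMap R A r ∈ A⁰ := by
    rw [← hrt]
    exact mul_mem hα (IsLocalization.map_units A t).mem_nonZeroDivisors
  have hαF : MvPolynomial.C α * F ∈ symDefiningIdeal A a' := by
    change symPresentation A a' (MvPolynomial.C α * F) = 0
    rw [← MvPolynomial.smul_eq_C_mul, map_smul, hαx]
  have hrf : algebraMap B B' (MvPolynomial.C r * f) ∈
      (symDefiningIdeal R a).map (algebraMap B B') := by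
    rw [← hI', map_mul, ← hf, hmap, MvPolynomial.map_C, ← hrt, map_mul]
    have : MvPolynomial.C α * MvPolynomial.C (algebraMap R A t) *
        (F * MvPolynomial.map (algebraMap R A) (MvPolynomial.C s)) =
        (MvPolynomial.C (algebraMap R A t) * MvPolynomial.map (algebraMap R A) (MvPolynomial.C s)) *
          (MvPolynomial.C α * F) := by ring
    rw [this]
    exact Ideal.mul_mem_left _ _ hαF
  rw [IsLocalization.algebraMap_mem_map_algebraMap_iff
      (p.primeCompl.map (MvPolynomial.C (σ := Fin n) (R := R)))] at hrf
  obtain ⟨_, ⟨u, hu, rfl⟩, huf⟩ := hrf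
  have hur : (u * r) • symPresentation R a f = 0 := by
    rw [← map_smul, MvPolynomial.smul_eq_C_mul, MvPolynomial.C_mul, mul_assoc]
    exact huf
  obtain ⟨v, hv, hvf⟩ := exists_notMem_smul_eq_zero_of_smul_eq_zero p hAss hr hu hur
  have hvF : algebraMap B B' (MvPolynomial.C v * f) ∈ symDefiningIdeal A a' := by
    rw [hI']
    refine Ideal.mem_map_of_mem _ ?_
    change symPresentation R a (MvPolynomial.C v * f) = 0
    rw [← MvPolynomial.smul_eq_C_mul, map_smul, hvf]
  rw [map_mul, ← hf] at hvF
  have hunit : IsUnit (algebraMap B B' (MvPolynomial.C v) * algebraMap B B' (MvPolynomial.C s)) :=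
    IsUnit.mul
      (IsLocalization.map_units B' (⟨_, v, hv, rfl⟩ :
        p.primeCompl.map (MvPolynomial.C (σ := Fin n) (R := R))))
      (IsLocalization.map_units B' (⟨_, s, hs, rfl⟩ :
        p.primeCompl.map (MvPolynomial.C (σ := Fin n) (R := R))))
  rw [mul_comm F, ← mul_assoc] at hvF
  exact (Ideal.unit_mul_mem_iff_mem _ hunit).mp hvF

/-- Relating the defining ideal of the Rees algebra with a saturation. -/
lemma reesDefiningIdeal_eq_idealSaturation {E : Type*} [AddCommGroup E] [Module R E] (I : Ideal R)
    (hI : (reesTorsionIdeal R E).restrictScalars R =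
      localCohomologyZero I (SymmetricAlgebra R E)) {n : ℕ} (a : Fin n → E) :
    reesDefiningIdeal R a = idealSaturation (symDefiningIdeal R a) I := by
  ext f
  have h1 : f ∈ reesDefiningIdeal R a ↔
      symPresentation R a f ∈ (reesTorsionIdeal R E).restrictScalars R :=
    Ideal.Quotient.eq_zero_iff_mem
  rw [h1, hI]
  constructor
  · rintro ⟨k, hk⟩
    refine ⟨k, fun c hc => ?_⟩
    rw [← Ideal.map_pow] at hc
    suffices hle : (I ^ k).map (algebraMap R (MvPolynomial (Fin n) R)) ≤
        Submodule.comap (LinearMap.mulRight (MvPolynomial (Fin n) R) f) (symDefiningIdeal R a)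
      from hle hc
    rw [Ideal.map_le_iff_le_comap]
    intro r hr
    change symPresentation R a (algebraMap R _ r * f) = 0
    rw [← Algebra.smul_def, map_smul]
    exact hk r hr
  · rintro ⟨k, hk⟩
    refine ⟨k, fun r hr => ?_⟩
    have := hk (algebraMap R _ r) (by rw [← Ideal.map_pow]; exact Ideal.mem_map_of_mem _ hr)
    rw [← Algebra.smul_def] at this
    rw [← map_smul]
    exact this

/-- Linear forms have zero constant term, so they generate a proper ideal. -/
lemma isRegular_of_isWeaklyRegular_linearForms [Nontrivial R] {d n : ℕ} {φ : Fin d → Fin n → R}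
    (h : RingTheory.Sequence.IsWeaklyRegular (MvPolynomial (Fin n) R) (linearForms φ)) :
    RingTheory.Sequence.IsRegular (MvPolynomial (Fin n) R) (linearForms φ) := by
  refine ⟨h, fun htop => ?_⟩
  rw [smul_eq_mul, Ideal.mul_top, ofList_linearForms, eq_comm, Ideal.eq_top_iff_one] at htop
  have hle : Ideal.span (Set.range fun j => linearForm R (φ j)) ≤
      RingHom.ker (MvPolynomial.constantCoeff (σ := Fin n) (R := R)) := by
    rw [Ideal.span_le]
    rintro _ ⟨j, rfl⟩
    simp [linearForm_apply, RingHom.mem_ker]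
  have := hle htop
  simp [RingHom.mem_ker] at this

lemma IsCohenMacaulayLocalRing.exists_mem_nonZeroDivisors [IsLocalRing R]
    (hR : IsCohenMacaulayLocalRing R) (hdim : ringKrullDim R ≠ 0) :
    ∃ r ∈ IsLocalRing.maximalIdeal R, r ∈ R⁰ := by
  obtain ⟨_, rs, hmem, hreg, hlen⟩ := hR
  match rs with
  | [] => exact (hdim (by rw [← hlen]; simp)).elim
  | r :: rs =>
    refine ⟨r, hmem r List.mem_cons_self, ?_⟩
    have h := ((RingTheory.Sequence.isWeaklyRegular_cons_iff R r rs).mp hreg.toIsWeaklyRegular).1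
    rw [mem_nonZeroDivisors_iff_right]
    intro x hx
    exact h (by simpa [mul_comm] using hx)

end Rees

theorem mainTheorem5 (R : Type u) [CommRing R] [IsLocalRing R]
    (hCM : IsCohenMacaulayLocalRing R) (d : ℕ) (hd : ringKrullDim R = d)
    (E : Type u) [AddCommGroup E] [Module R E] [Module.Finite R E]
    (htf : Module.IsTorsionFree R E)
    (e : ℕ) (he : 1 ≤ e) (hrank : HasModuleRank R E e)
    (hG : SatisfiesG R E e d)
    (hmu : minGenerators R E = d + e)
    (hpd : CategoryTheory.projectiveDimension (ModuleCat.of R E) = 1) :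
    -- (a) the defining ideal of the symmetric algebra is generated by a regular sequence
    (∀ a : Fin (d + e) → E, Submodule.span R (Set.range a) = ⊤ →
      ∃ rs : List (MvPolynomial (Fin (d + e)) R),
        RingTheory.Sequence.IsRegular (MvPolynomial (Fin (d + e)) R) rs ∧
        symDefiningIdeal R a = Ideal.ofList rs) ∧
    -- (b) `E` is of linear type on the punctured spectrum
    (∀ (p : Ideal R) [p.IsPrime], p ≠ IsLocalRing.maximalIdeal R →
      Subsingleton (LocalizedModule p.primeCompl (reesTorsionIdeal R E)) ∧
      IsOfLinearType (Localization.AtPrime p) (LocalizedModule p.primeCompl E)) ∧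
    -- `𝒜 = H⁰_𝔪(𝒮(E))`, as submodules of `𝒮(E)`
    (reesTorsionIdeal R E).restrictScalars R =
      localCohomologyZero (IsLocalRing.maximalIdeal R) (SymmetricAlgebra R E) ∧
    -- `𝒥 = ℒ : 𝔪^∞`
    (∀ a : Fin (d + e) → E, Submodule.span R (Set.range a) = ⊤ →
      reesDefiningIdeal R a =
        idealSaturation (symDefiningIdeal R a) (IsLocalRing.maximalIdeal R)) := by
  have hNoeth := hCM.1
  have hrel := fun a ha => exists_relations (d := d) hrank hpd.le a ha
  obtain ⟨a, ha⟩ := exists_span_range_eq_top_of_minGenerators hmu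
  obtain ⟨φ, hφ⟩ := hrel a ha
  have hφr := hasLargeRank_of_satisfiesG hd hrank hG a ha φ hφ
  have hAss : ∀ q : Ideal R, IsAssociatedPrime q (SymmetricAlgebra R E) →
      q ≠ IsLocalRing.maximalIdeal R → q ∈ minimalPrimes R := by
    intro q hq
    refine hφr.mem_minimalPrimes_of_isAssociatedPrime hCM q ?_
    have hker : RingHom.ker (symPresentation R a) = Ideal.ofList (linearForms φ) := by
      rw [ofList_linearForms]
      exact symDefiningIdeal_eq_span a ha φ hφ
    rw [← hker]
    exact (LinearEquiv.isAssociatedPrime_iff (Ideal.quotientKerAlgEquivOfSurjective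
      (symPresentation_surjective a ha)).toLinearEquiv).mpr hq
  have htors : (reesTorsionIdeal R E).restrictScalars R =
      localCohomologyZero (IsLocalRing.maximalIdeal R) (SymmetricAlgebra R E) := by
    ext x
    constructor
    · intro hx
      obtain ⟨r, hr, hrx⟩ := mem_reesTorsionIdeal_iff.mp hx
      exact exists_pow_smul_eq_zero_of_torsion hAss hr hrx
    · rintro ⟨k, hk⟩
      -- If `d = 0` there are no relations, so `E` is free, against projective dimension exactly
      -- one. Positive dimension puts a nonzerodivisor in `𝔪`, so elements killed by a power of `𝔪`
      -- are torsion.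
      have hd0 : ringKrullDim R ≠ 0 := by
        rintro h0
        rw [hd] at h0
        obtain rfl : d = 0 := by exact_mod_cast h0
        have hbij : Function.Bijective (Fintype.linearCombination R a) := by
          refine ⟨(injective_iff_map_eq_zero _).mpr fun w hw => ?_, ?_⟩
          · have := (hφ w).mp hw
            simpa using this
          · rw [← LinearMap.range_eq_top, Fintype.range_linearCombination, ha]
        have hproj : Module.Projective R E :=
          Module.Projective.of_equiv (LinearEquiv.ofBijective _ hbij)
        have : CategoryTheory.Projective (ModuleCat.of R E) :=
          (IsProjective.iff_projective (R := R) E).mp hproj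
        have h1 := (CategoryTheory.projectiveDimension_le_iff (ModuleCat.of R E) 0).mpr
          (CategoryTheory.projective_iff_hasProjectiveDimensionLT_one.mp this)
        rw [hpd] at h1
        exact absurd h1 (by decide)
      obtain ⟨r, hrm, hr⟩ := hCM.exists_mem_nonZeroDivisors hd0
      exact mem_reesTorsionIdeal_iff.mpr
        ⟨r ^ k, pow_mem hr k, hk _ (Ideal.pow_mem_pow hrm k)⟩
  refine ⟨fun b hb => ?_, fun p _ hp => ⟨?_, ?_⟩, htors, fun b _ =>
    reesDefiningIdeal_eq_idealSaturation _ htors b⟩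
  · obtain ⟨ψ, hψ⟩ := hrel b hb
    have hψr := hasLargeRank_of_satisfiesG hd hrank hG b hb ψ hψ
    exact ⟨linearForms ψ,
      isRegular_of_isWeaklyRegular_linearForms (hψr.isWeaklyRegular hCM), by
        rw [ofList_linearForms]
        exact symDefiningIdeal_eq_span b hb ψ hψ⟩
  · rw [LocalizedModule.subsingleton_iff]
    rintro ⟨x, hx⟩
    obtain ⟨k, hk⟩ : x ∈ localCohomologyZero (IsLocalRing.maximalIdeal R)
      (SymmetricAlgebra R E) := htors ▸ hx
    -- A power of any `s ∈ 𝔪` outside `p` kills the given torsion element.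
    obtain ⟨s, hsm, hsp⟩ := SetLike.exists_of_lt
      (lt_of_le_of_ne (IsLocalRing.le_maximalIdeal (Ideal.IsPrime.ne_top ‹p.IsPrime›)) hp)
    exact ⟨s ^ k, pow_mem (S := p.primeCompl) hsp k,
      Subtype.ext (hk _ (Ideal.pow_mem_pow hsm k))⟩
  · refine isOfLinearType_localizedModule a ha φ hφ p fun q hq hqp => hAss q hq ?_
    rintro rfl
    exact hp (le_antisymm (IsLocalRing.le_maximalIdeal (Ideal.IsPrime.ne_top ‹p.IsPrime›)) hqp)
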